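/- Let $\Omega\subset\mathbb{R}^d$ be open. For $s\in\mathbb{R}$ and $p>1$ let $B^s_p=B^s_{p,p}(\Omega)$ be the Besov space of (real- or complex-valued) distributions on $\Omega$ that are restrictions of elements of $B^s_{p,p}(\mathbb{R}^d)$, and let $\mathcal{B}_D=B^{s_D}_{p_D}$ and $\mathcal{B}_R=B^{s_R}_{p_R}$ with $s_D,s_R\in\mathbb{R}$, $p_D>1$, $p_R>1$, be such that $\mathcal{B}_R\subset\mathcal{B}_D$ with continuous embedding. Let $(\psi_\lambda)_{\lambda\in\Lambda}$ be a wavelet basis for $\mathcal{B}_R$, that is, a Riesz basis of $L_2(\Omega)$ with scales $|\lambda|\in\mathbb{N}_0$ such that, with the wavelet coefficients $u_\lambda=\langle u,\psi_\lambda\rangle$ (the continuous extension of $\int_\Omega u\,\psi_\lambda\,dx$ to $u\in\mathcal{B}_R$), the expression $$\|u\|_{\mathcal{B}_R}:=\Big(\sum_{\lambda\in\Lambda}2^{p_R\left(s_R+d\left(\frac12-\frac1{p_R}\right)\right)|\lambda|}\,|u_\lambda|^{p_R}\Big)^{1/p_R}$$ is equivalent to the usual norm of $B^{s_R}_{p_R}$.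 Equip $\mathcal{B}_R$ with this norm, and put $\|u\|_{\mathcal{B}_R}=\infty$ for $u\in\mathcal{B}_D\setminus\mathcal{B}_R$. Let $F:\mathcal{B}_D\to L_2(\Omega)$ be linear and continuous, let $v\in L_2(\Omega)$, and let $u^\dagger\in\mathcal{B}_R$ be a minimum-$\|\cdot\|_{\mathcal{B}_R}$ solution of $Fu=v$, i.e. $Fu^\dagger=v$, $\|u^\dagger\|_{\mathcal{B}_R}<\infty$, and $\|u^\dagger\|_{\mathcal{B}_R}\le\|w\|_{\mathcal{B}_R}$ for every $w\in\mathcal{B}_D$ with $Fw=v$. For noise levels $\delta>0$ let $v^\delta\in L_2(\Omega)$ satisfy $\|v-v^\delta\|_{L_2}\le\delta$, let the regularization parameters satisfy $c\,\delta\le\alpha\le C\,\delta$ with constants $c,C>0$ independent of $\delta$, and let $u^{\alpha,\delta}\in\mathcal{B}_D$ be any minimizer over $\mathcal{B}_D$ of $$T_\alpha(u)=\|Fu-v^\delta\|_{L_2}^2+\alpha\|u\|_{\mathcal{B}_R}^{p_R}.$$ Then $\|u^{\alpha,\delta}-u^\dagger\|_{\mathcal{B}_R}\to0$ as $\delta\to0$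 (along every sequence, and more generally every net or filter, of noise levels tending to $0$ from above). -/

import Mathlib

open MeasureTheory Filter Topology TopologicalSpace
open scoped ENNReal NNReal SchwartzMap Distributions ContDiff

noncomputable section

namespace BesovTikhonov

/-- The Euclidean space `ℝᵈ`. -/
abbrev Space (d : ℕ) : Type := EuclideanSpace ℝ (Fin d)

/-! ### Littlewood–Paley decomposition and Besov spaces on `ℝᵈ` -/

/-- A smooth cut-off function on `ℝᵈ`, equal to `1` on the ball of radius `1` and vanishing outside
the ball of radius `2`. -/
def cutoff (d : ℕ) : ContDiffBump (0 : Space d) where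
  rIn := 1
  rOut := 2
  rIn_pos := one_pos
  rIn_lt_rOut := one_lt_two

/-- The smooth dyadic resolution of unity `χ₀ = χ`, `χⱼ(ξ) = χ(2⁻ʲ ξ) - χ(2¹⁻ʲ ξ)` for `j ≥ 1`. -/
def dyadicSymbol (d : ℕ) : ℕ → Space d → ℝ
  | 0 => fun ξ => cutoff d ξ
  | j + 1 => fun ξ => cutoff d ((2⁻¹ : ℝ) ^ (j + 1) • ξ) - cutoff d ((2⁻¹ : ℝ) ^ j • ξ)

theorem contDiff_cutoff_smul (d : ℕ) (c : ℝ) :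
    ContDiff ℝ ∞ (fun ξ : Space d => cutoff d (c • ξ)) :=
  (cutoff d).contDiff.comp (contDiff_const_smul c)

theorem hasCompactSupport_cutoff_smul (d : ℕ) {c : ℝ} (hc : c ≠ 0) :
    HasCompactSupport (fun ξ : Space d => cutoff d (c • ξ)) :=
  (cutoff d).hasCompactSupport.comp_smul hc

/-- The symbols have temperate growth, so that the Fourier multipliers below are the genuine ones
(and not the default value that Mathlib assigns to other symbols). -/
theorem hasTemperateGrowth_dyadicSymbol (d j : ℕ) :
    (fun ξ : Space d => (dyadicSymbol d j ξ : ℂ)).HasTemperateGrowth := by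
  have key : (dyadicSymbol d j).HasTemperateGrowth := by
    cases j with
    | zero =>
      exact (cutoff d).hasCompactSupport.hasTemperateGrowth (cutoff d).contDiff
    | succ j =>
      exact ((hasCompactSupport_cutoff_smul d (by positivity)).hasTemperateGrowth
          (contDiff_cutoff_smul d _)).sub
        ((hasCompactSupport_cutoff_smul d (by positivity)).hasTemperateGrowth
          (contDiff_cutoff_smul d _))
  exact Function.Complex.hasTemperateGrowth_ofReal.comp key

/-- The Littlewood–Paley block `Δⱼ U = 𝓕⁻¹ (χⱼ 𝓕 U)` of a tempered distribution. -/
def lpBlock {d : ℕ} (j : ℕ) (U : 𝓢'(Space d, ℂ)) : 𝓢'(Space d, ℂ) :=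
  TemperedDistribution.fourierMultiplierCLM ℂ (fun ξ => (dyadicSymbol d j ξ : ℂ)) U

/-- `g` is an `Lᵖ` function representing the tempered distribution `T`. -/
def IsLpDensity {d : ℕ} (p : ℝ≥0∞) (T : 𝓢'(Space d, ℂ)) (g : Space d → ℂ) : Prop :=
  MemLp g p volume ∧ ∀ φ : 𝓢(Space d, ℂ), T φ = ∫ x, φ x * g x

/-- The `Lᵖ` norm of a tempered distribution: `‖g‖_{Lᵖ}` if it is represented by `g ∈ Lᵖ` (which is
then unique almost everywhere), and `∞` if there is no such `g`. -/
def distLpNorm {d : ℕ} (p : ℝ≥0∞) (T : 𝓢'(Space d, ℂ)) : ℝ≥0∞ :=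
  ⨅ (g : Space d → ℂ) (_ : IsLpDensity p T g), eLpNorm g p volume

/-- The Besov norm of `B^s_{p,p}(ℝᵈ)`, with values in `[0, ∞]`:
`‖U‖ = (∑ⱼ (2^{js} ‖Δⱼ U‖_{Lᵖ})ᵖ)^{1/p}`. -/
def besovNormWhole {d : ℕ} (s p : ℝ) (U : 𝓢'(Space d, ℂ)) : ℝ≥0∞ :=
  (∑' j : ℕ, (ENNReal.ofReal ((2 : ℝ) ^ ((j : ℝ) * s)) *
    distLpNorm (ENNReal.ofReal p) (lpBlock j U)) ^ p) ^ (1 / p)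

theorem distLpNorm_add_le {d : ℕ} {p : ℝ≥0∞} (hp : 1 ≤ p) (S T : 𝓢'(Space d, ℂ)) :
    distLpNorm p (S + T) ≤ distLpNorm p S + distLpNorm p T := by
  have hint : ∀ {R : 𝓢'(Space d, ℂ)} {g : Space d → ℂ}, IsLpDensity p R g →
      ∀ φ : 𝓢(Space d, ℂ), Integrable (fun x => φ x * g x) := by
    intro R g hg φ
    have := ENNReal.HolderConjugate.inv_one_sub_inv' hp
    exact MemLp.integrable_mul (φ.memLp ((1 - p⁻¹)⁻¹)) hg.1
  unfold distLpNorm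
  simp only [ENNReal.iInf_add, ENNReal.add_iInf]
  refine le_iInf₂ fun h hh => le_iInf₂ fun g hg => ?_
  refine iInf₂_le_of_le (g + h) ⟨hg.1.add hh.1, fun φ => ?_⟩
    (eLpNorm_add_le hg.1.1 hh.1.1 hp)
  have h1 : (S + T) φ = S φ + T φ := rfl
  rw [h1, hg.2 φ, hh.2 φ, ← integral_add (hint hg φ) (hint hh φ)]
  simp [mul_add]

theorem distLpNorm_zero {d : ℕ} (p : ℝ≥0∞) : distLpNorm p (0 : 𝓢'(Space d, ℂ)) = 0 := by
  refine le_antisymm (iInf₂_le_of_le 0 ⟨MemLp.zero, ?_⟩ (by simp)) bot_le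
  intro φ
  have h1 : (0 : 𝓢'(Space d, ℂ)) φ = 0 := rfl
  simp [h1]

theorem distLpNorm_smul_le {d : ℕ} (p : ℝ≥0∞) (c : ℂ) (T : 𝓢'(Space d, ℂ)) :
    distLpNorm p (c • T) ≤ ‖c‖ₑ * distLpNorm p T := by
  have step : ∀ g, IsLpDensity p T g → distLpNorm p (c • T) ≤ ‖c‖ₑ * eLpNorm g p volume := by
    intro g hg
    refine iInf₂_le_of_le (c • g) ⟨hg.1.const_smul c, fun φ => ?_⟩ eLpNorm_const_smul_le
    have h1 : (c • T) φ = c * T φ := rfl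
    rw [h1, hg.2 φ, ← integral_const_mul]
    simp [mul_left_comm]
  rcases eq_or_ne c 0 with rfl | hc
  · have h0 : (0 : ℂ) • T = 0 := zero_smul ℂ T
    rw [h0, distLpNorm_zero]
    exact bot_le
  · conv_rhs => unfold distLpNorm
    rw [ENNReal.mul_iInf_of_ne (by simpa using hc) (by finiteness)]
    refine le_iInf fun g => ?_
    rw [ENNReal.mul_iInf_of_ne (by simpa using hc) (by finiteness)]
    exact le_iInf fun hg => step g hg

theorem besovNormWhole_lt_top_iff {d : ℕ} {s p : ℝ} (hp : 1 ≤ p) (U : 𝓢'(Space d, ℂ)) :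
    besovNormWhole s p U < ⊤ ↔ ∑' j : ℕ, (ENNReal.ofReal ((2 : ℝ) ^ ((j : ℝ) * s)) *
      distLpNorm (ENNReal.ofReal p) (lpBlock j U)) ^ p < ⊤ := by
  unfold besovNormWhole
  exact ENNReal.rpow_lt_top_iff_of_pos (by positivity)

theorem besovNormWhole_add_lt_top {d : ℕ} {s p : ℝ} (hp : 1 ≤ p) {U V : 𝓢'(Space d, ℂ)}
    (hU : besovNormWhole s p U < ⊤) (hV : besovNormWhole s p V < ⊤) :
    besovNormWhole s p (U + V) < ⊤ := by
  rw [besovNormWhole_lt_top_iff hp] at *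
  have hp' : 1 ≤ ENNReal.ofReal p := by simpa using ENNReal.ofReal_le_ofReal hp
  refine lt_of_le_of_lt (b := 2 ^ (p - 1) * (_ + _)) ?_
    (ENNReal.mul_lt_top (by finiteness) (ENNReal.add_lt_top.2 ⟨hU, hV⟩))
  rw [← ENNReal.tsum_add, ← ENNReal.tsum_mul_left]
  refine ENNReal.tsum_le_tsum fun j => ?_
  refine le_trans ?_ (ENNReal.rpow_add_le_mul_rpow_add_rpow _ _ hp)
  rw [← mul_add]
  gcongr
  have : lpBlock j (U + V) = lpBlock j U + lpBlock j V := map_add _ _ _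
  rw [this]
  exact distLpNorm_add_le hp' _ _

theorem besovNormWhole_smul_lt_top {d : ℕ} {s p : ℝ} (hp : 1 ≤ p) (c : ℂ) {U : 𝓢'(Space d, ℂ)}
    (hU : besovNormWhole s p U < ⊤) : besovNormWhole s p (c • U) < ⊤ := by
  have hp0 : 0 ≤ p := by linarith
  rw [besovNormWhole_lt_top_iff hp] at *
  refine lt_of_le_of_lt (b := ‖c‖ₑ ^ p * _) ?_ (ENNReal.mul_lt_top (by finiteness) hU)
  rw [← ENNReal.tsum_mul_left]
  refine ENNReal.tsum_le_tsum fun j => ?_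
  rw [← ENNReal.mul_rpow_of_nonneg _ _ hp0, mul_left_comm]
  gcongr
  have : lpBlock j (c • U) = c • lpBlock j U := map_smul _ _ _
  rw [this]
  exact distLpNorm_smul_le _ _ _

theorem besovNormWhole_zero {d : ℕ} {s p : ℝ} (hp : 1 ≤ p) :
    besovNormWhole s p (0 : 𝓢'(Space d, ℂ)) < ⊤ := by
  have h0 : ∀ j, distLpNorm (ENNReal.ofReal p) (lpBlock j (0 : 𝓢'(Space d, ℂ))) = 0 := by
    intro j
    have : lpBlock j (0 : 𝓢'(Space d, ℂ)) = 0 := map_zero _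
    rw [this]
    exact distLpNorm_zero _
  rw [besovNormWhole_lt_top_iff hp]
  simp [h0, ENNReal.zero_rpow_of_pos (by linarith : 0 < p)]

/-! ### Besov spaces on an open set `Ω ⊆ ℝᵈ` (real or complex valued) -/

section Domain

variable {𝕜 : Type*} [RCLike 𝕜] {d : ℕ} {Ω : Opens (Space d)}

/-- A real test function on `Ω`, extended by zero and viewed as a complex Schwartz function. -/
def testToSchwartz (φ : 𝓓(Ω, ℝ)) : 𝓢(Space d, ℂ) :=
  HasCompactSupport.toSchwartzMap (f := fun x => ((φ x : ℝ) : ℂ))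
    (φ.hasCompactSupport.comp_left (g := fun t : ℝ => (t : ℂ)) Complex.ofReal_zero)
    (Complex.ofRealCLM.contDiff.comp φ.contDiff)

/-- `T` is the restriction to `Ω` of the tempered distribution `U`. -/
def IsRestriction (U : 𝓢'(Space d, ℂ)) (T : 𝓓'(Ω, 𝕜)) : Prop :=
  ∀ φ : 𝓓(Ω, ℝ), RCLike.map 𝕜 ℂ (T φ) = U (testToSchwartz φ)

/-- The norm of `B^s_p(Ω) = B^s_{p,p}(Ω)`, with values in `[0, ∞]`: the infimum of the norms of all
extensions to `ℝᵈ`. -/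
def besovNorm (s p : ℝ) (T : 𝓓'(Ω, 𝕜)) : ℝ≥0∞ :=
  ⨅ (U : 𝓢'(Space d, ℂ)) (_ : IsRestriction U T), besovNormWhole s p U

theorem besovNorm_lt_top_iff (s p : ℝ) (T : 𝓓'(Ω, 𝕜)) :
    besovNorm s p T < ⊤ ↔
      ∃ U : 𝓢'(Space d, ℂ), IsRestriction U T ∧ besovNormWhole s p U < ⊤ := by
  simp only [besovNorm, iInf_lt_iff, exists_prop]

theorem map_mul' (a b : 𝕜) : RCLike.map 𝕜 ℂ (a * b) = RCLike.map 𝕜 ℂ a * RCLike.map 𝕜 ℂ b := by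
  apply Complex.ext <;> simp [RCLike.map_apply]

variable (𝕜 Ω) in
/-- The Besov space `B^s_p(Ω) = B^s_{p,p}(Ω)` of `𝕜`-valued distributions on `Ω`: the restrictions
to `Ω` of the elements of `B^s_{p,p}(ℝᵈ)`. -/
def besovSpace (s p : ℝ) (hp : 1 ≤ p) : Submodule 𝕜 𝓓'(Ω, 𝕜) where
  carrier := {T | besovNorm s p T < ⊤}
  zero_mem' := (besovNorm_lt_top_iff s p _).2 ⟨0, fun φ => by simp, besovNormWhole_zero hp⟩
  add_mem' {S T} hS hT := by
    obtain ⟨U, hU, hU'⟩ := (besovNorm_lt_top_iff s p _).1 hS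
    obtain ⟨V, hV, hV'⟩ := (besovNorm_lt_top_iff s p _).1 hT
    refine (besovNorm_lt_top_iff s p _).2
      ⟨U + V, fun φ => ?_, besovNormWhole_add_lt_top hp hU' hV'⟩
    change RCLike.map 𝕜 ℂ (S φ + T φ) = U (testToSchwartz φ) + V (testToSchwartz φ)
    rw [map_add, hU φ, hV φ]
  smul_mem' c T hT := by
    obtain ⟨U, hU, hU'⟩ := (besovNorm_lt_top_iff s p _).1 hT
    refine (besovNorm_lt_top_iff s p _).2
      ⟨RCLike.map 𝕜 ℂ c • U, fun φ => ?_, besovNormWhole_smul_lt_top hp _ hU'⟩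
    change RCLike.map 𝕜 ℂ (c * T φ) = RCLike.map 𝕜 ℂ c * U (testToSchwartz φ)
    rw [map_mul', hU φ]

variable (𝕜 Ω) in
/-- The embedding `B^{s₁}_{p₁}(Ω) ⊂ B^{s₂}_{p₂}(Ω)`: set-theoretic and continuous. (For
`T ∈ B^{s₁}_{p₁}(Ω)` the right-hand side is finite, so `T ∈ B^{s₂}_{p₂}(Ω)` is part of it.) -/
def BesovEmbeds (s₁ p₁ s₂ p₂ : ℝ) : Prop :=
  ∃ C : ℝ≥0, ∀ T : 𝓓'(Ω, 𝕜), besovNorm s₁ p₁ T < ⊤ → besovNorm s₂ p₂ T ≤ C * besovNorm s₁ p₁ T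

/-! ### Wavelet bases and the wavelet norm -/

variable (𝕜 Ω) in
/-- The Lebesgue space `L₂(Ω)`. -/
abbrev L2 : Type _ := Lp 𝕜 2 (volume.restrict (Ω : Set (Space d)))

/-- `ψ` is a Riesz basis of `L₂(Ω)`; every orthonormal basis is one. -/
def IsRieszBasis {Λ : Type*} (ψ : Λ → L2 𝕜 Ω) : Prop :=
  (Submodule.span 𝕜 (Set.range ψ)).topologicalClosure = ⊤ ∧
  ∃ c C : ℝ, 0 < c ∧ 0 < C ∧ ∀ a : Λ →₀ 𝕜,
    c * (a.sum fun _ z => ‖z‖ ^ 2) ≤ ‖a.sum fun l z => z • ψ l‖ ^ 2 ∧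
    ‖a.sum fun l z => z • ψ l‖ ^ 2 ≤ C * (a.sum fun _ z => ‖z‖ ^ 2)

variable (𝕜 Ω) in
/-- A wavelet basis `(ψ_λ)_{λ ∈ Λ}` for the Besov space `B^s_p(Ω)`: a Riesz basis of `L₂(Ω)`
(not necessarily orthonormal), with scales `|λ| ∈ ℕ`, whose wavelet coefficients
`u_λ = ⟨u, ψ_λ⟩ = ∫ u ψ_λ dx` describe the Besov norm,
`‖u‖_{B^s_p}^p ≍ ∑_λ 2^{p (s + d (1/2 - 1/p)) |λ|} |u_λ|^p`.

A general `u ∈ B^s_p(Ω)` is a distribution and `ψ_λ` need not be a test function, so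
`⟨u, ψ_λ⟩` is the duality pairing, that is the extension by continuity of the integral: `coeff l` is
a linear functional, by `norm_equiv` it is continuous on `B^s_p(Ω)`, and by `coeff_eq_integral` it
is the integral against `ψ_λ` on the restrictions to `Ω` of Schwartz functions, which are dense. -/
structure BesovWaveletBasis (s p : ℝ) (hp : 1 ≤ p) (Λ : Type*) where
  /-- the scale `|λ|` -/
  scale : Λ → ℕ
  /-- the wavelets `ψ_λ` -/
  ψ : Λ → L2 𝕜 Ω
  isRieszBasis : IsRieszBasis ψ
  /-- the coefficients `u_λ = ⟨u, ψ_λ⟩` -/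
  coeff : Λ → besovSpace 𝕜 Ω s p hp →ₗ[𝕜] 𝕜
  coeff_eq_integral : ∀ (l : Λ) (u : besovSpace 𝕜 Ω s p hp) (f : 𝓢(Space d, 𝕜)),
    (∀ φ : 𝓓(Ω, ℝ), (u : 𝓓'(Ω, 𝕜)) φ = ∫ x, φ x • f x) →
      coeff l u = ∫ x in (Ω : Set (Space d)), f x * ψ l x
  norm_equiv : ∃ c C : ℝ≥0, 0 < c ∧ 0 < C ∧ ∀ u : besovSpace 𝕜 Ω s p hp,
    let E : ℝ≥0∞ := ∑' l : Λ, ENNReal.ofReal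
      ((2 : ℝ) ^ (p * (s + d * (1 / 2 - 1 / p)) * (scale l : ℝ))) * ‖coeff l u‖ₑ ^ p
    c * besovNorm s p (u : 𝓓'(Ω, 𝕜)) ^ p ≤ E ∧ E ≤ C * besovNorm s p (u : 𝓓'(Ω, 𝕜)) ^ p

open Classical in
/-- The wavelet norm `‖T‖_{B^s_p} = (∑_λ 2^{p (s + d (1/2 - 1/p)) |λ|} |T_λ|^p)^{1/p}`, set to `∞`
for a distribution `T` outside `B^s_p(Ω)`. -/
def BesovWaveletBasis.norm {s p : ℝ} {hp : 1 ≤ p} {Λ : Type*}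
    (W : BesovWaveletBasis 𝕜 Ω s p hp Λ) (T : 𝓓'(Ω, 𝕜)) : ℝ≥0∞ :=
  if hT : T ∈ besovSpace 𝕜 Ω s p hp then
    (∑' l : Λ, ENNReal.ofReal
      ((2 : ℝ) ^ (p * (s + d * (1 / 2 - 1 / p)) * (W.scale l : ℝ))) *
        ‖W.coeff l ⟨T, hT⟩‖ₑ ^ p) ^ (1 / p)
  else ⊤

/-! ### Tikhonov regularization -/

/-- The linear operator `F : B^s_p(Ω) → L₂(Ω)` is continuous, i.e. bounded. -/
def IsBoundedOp {s p : ℝ} {hp : 1 ≤ p} (F : besovSpace 𝕜 Ω s p hp →ₗ[𝕜] L2 𝕜 Ω) : Prop :=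
  ∃ C : ℝ≥0, ∀ u : besovSpace 𝕜 Ω s p hp, ‖F u‖ₑ ≤ C * besovNorm s p (u : 𝓓'(Ω, 𝕜))

variable {sD pD sR pR : ℝ} {hpD : 1 ≤ pD} {hpR : 1 ≤ pR} {Λ : Type*}

/-- The Tikhonov functional `T_α(u) = ‖F u - w‖² + α ‖u‖_{B_R}^{p_R}` on `B_D`, with values in
`[0, ∞]`, for the data `w`. -/
def tikhonov (W : BesovWaveletBasis 𝕜 Ω sR pR hpR Λ)
    (F : besovSpace 𝕜 Ω sD pD hpD →ₗ[𝕜] L2 𝕜 Ω) (w : L2 𝕜 Ω) (α : ℝ)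
    (u : besovSpace 𝕜 Ω sD pD hpD) : ℝ≥0∞ :=
  ‖F u - w‖ₑ ^ 2 + ENNReal.ofReal α * W.norm (u : 𝓓'(Ω, 𝕜)) ^ pR

/-- `u` is a minimum-`‖·‖_{B_R}` solution of `F u = v`: it is a solution of finite `B_R`-norm, and no
solution in `B_D` has a smaller `B_R`-norm. -/
def IsMinNormSolution (W : BesovWaveletBasis 𝕜 Ω sR pR hpR Λ)
    (F : besovSpace 𝕜 Ω sD pD hpD →ₗ[𝕜] L2 𝕜 Ω) (v : L2 𝕜 Ω)
    (u : besovSpace 𝕜 Ω sD pD hpD) : Prop :=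
  F u = v ∧ W.norm (u : 𝓓'(Ω, 𝕜)) < ⊤ ∧
    ∀ w : besovSpace 𝕜 Ω sD pD hpD, F w = v → W.norm (u : 𝓓'(Ω, 𝕜)) ≤ W.norm (w : 𝓓'(Ω, 𝕜))

end Domain

end BesovTikhonov

end

open BesovTikhonov

noncomputable section

namespace BesovTikhonov

/-! ### Uniform convexity of `ℓᵖ` -/

section UniformConvexity

variable {E : Type*} [NormedAddCommGroup E] [NormedSpace ℝ E]

/-! The weighted wavelet coefficients identify `B_R`, with the wavelet norm, with an additive
subgroup of `ℓᵖ(Λ)`, `p = p_R > 1`, so uniform convexity of `ℓᵖ` is available and no weak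
compactness is needed.

Comparing the minimizer with `u†` gives `‖u^{α,δ}‖ᵖ ≤ ‖u†‖ᵖ + δ²/α`. Since `α` is comparable to `δ`,
the excess tends to `0`, and so does the residual `F u^{α,δ} - v`. The midpoint of `u^{α,δ}` and
`u†` is then a near-solution too. Near-solutions cannot have norm much below `‖u†‖`
(`exists_le_norm_of_norm_sub_le`), so two vectors of norm nearly at most `‖u†‖` have a midpoint of
norm nearly at least `‖u†‖`, and uniform convexity (`UniformConvexPow.exists_bound`) forces them
together.

The lower bound for near-solutions comes from the same convexity argument: if it failed,
near-minimizers of the norm over shrinking residual balls would form a Cauchy sequence, whose limit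
would be an exact solution of smaller norm than `u†`. This needs limits to stay in `B_R`, that is,
closed range of the coefficient map (`exists_tendsto_toLp`), which follows from norm equivalence and
completeness of the Besov space. For completeness, a series with summable norms is lifted to `ℝᵈ`;
it converges there because the Besov space embeds in the tempered distributions
(`exists_seminorm_enorm_apply_le_besovNormWhole`), and the norm is countably subadditive. -/

theorem norm_midpoint_rpow_le {p : ℝ} (hp : 1 ≤ p) (a b : E) :
    ‖(1 / 2 : ℝ) • (a + b)‖ ^ p ≤ (‖a‖ ^ p + ‖b‖ ^ p) / 2 := by
  have h1 : ‖(1 / 2 : ℝ) • (a + b)‖ ≤ (1 / 2) * ‖a‖ + (1 / 2) * ‖b‖ := by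
    rw [norm_smul, ← mul_add]
    simpa using norm_add_le a b
  have h2 := (convexOn_rpow hp).2 (Set.mem_Ici.2 (norm_nonneg a)) (Set.mem_Ici.2 (norm_nonneg b))
    one_half_pos.le one_half_pos.le (add_halves 1)
  simp only [smul_eq_mul] at h2
  have h3 := Real.rpow_le_rpow (norm_nonneg _) h1 (by linarith : (0 : ℝ) ≤ p)
  linarith

theorem norm_midpoint_rpow_lt [StrictConvexSpace ℝ E] {p : ℝ} (hp : 1 < p) {a b : E}
    (hab : a ≠ b) : ‖(1 / 2 : ℝ) • (a + b)‖ ^ p < (‖a‖ ^ p + ‖b‖ ^ p) / 2 := by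
  have hp0 : 0 < p := by linarith
  by_cases hn : ‖a‖ = ‖b‖
  · have h1 : ‖(1 / 2 : ℝ) • a + (1 / 2 : ℝ) • b‖ < ‖b‖ :=
      norm_combo_lt_of_ne hn.le le_rfl hab (by norm_num) (by norm_num) (by norm_num)
    rw [← smul_add] at h1
    have := Real.rpow_lt_rpow (norm_nonneg _) h1 hp0
    rw [hn]
    linarith
  · have h1 : ‖(1 / 2 : ℝ) • (a + b)‖ ≤ (1 / 2) * ‖a‖ + (1 / 2) * ‖b‖ := by
      rw [norm_smul, ← mul_add]
      simpa using norm_add_le a b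
    have h2 := (strictConvexOn_rpow hp).2 (Set.mem_Ici.2 (norm_nonneg a))
      (Set.mem_Ici.2 (norm_nonneg b)) hn one_half_pos one_half_pos (add_halves 1)
    simp only [smul_eq_mul] at h2
    have h3 := Real.rpow_le_rpow (norm_nonneg _) h1 hp0.le
    linarith

/-- A quantitative form of uniform convexity of the function `‖·‖ᵖ`. -/
def UniformConvexPow (p : ℝ) (Y : Type*) [NormedAddCommGroup Y] [NormedSpace ℝ Y] : Prop :=
  ∀ ε : ℝ, 0 < ε → ∃ K : ℝ, 0 < K ∧ ∀ a b : Y,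
    ‖a - b‖ ^ p + K * ‖(1 / 2 : ℝ) • (a + b)‖ ^ p ≤ (ε + K / 2) * (‖a‖ ^ p + ‖b‖ ^ p)

/-- By homogeneity it suffices to treat pairs with `‖a‖ᵖ + ‖b‖ᵖ = 1`. Those with `‖a - b‖ᵖ ≥ ε` form
a compact set, on which the convexity gap has a positive minimum; for the others plain convexity is
enough. -/
theorem uniformConvexPow_of_strictConvexSpace [ProperSpace E] [StrictConvexSpace ℝ E] {p : ℝ}
    (hp : 1 < p) : UniformConvexPow p E := by
  intro ε hε
  have hp0 : 0 < p := by linarith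
  have hpow : ∀ f : E × E → E, Continuous f → Continuous fun x => ‖f x‖ ^ p := fun f hf =>
    hf.norm.rpow_const fun _ => Or.inr hp0.le
  have hcont : Continuous fun x : E × E => (‖x.1‖ ^ p + ‖x.2‖ ^ p) / 2 -
      ‖(1 / 2 : ℝ) • (x.1 + x.2)‖ ^ p :=
    (((hpow _ continuous_fst).add (hpow _ continuous_snd)).div_const 2).sub
      (hpow _ (by fun_prop))
  have hle : ∀ x y : E, ‖x‖ ^ p + ‖y‖ ^ p = 1 → ‖x‖ ≤ 1 := by
    intro x y h
    have : ‖x‖ ^ p ≤ 1 := by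
      have := Real.rpow_nonneg (norm_nonneg y) p
      linarith
    by_contra! h1
    exact absurd this (not_le.2 (Real.one_lt_rpow h1 hp0))
  set S : Set (E × E) := {x | ‖x.1‖ ^ p + ‖x.2‖ ^ p = 1 ∧ ε ≤ ‖x.1 - x.2‖ ^ p}
  have hS : IsCompact S := by
    refine Metric.isCompact_of_isClosed_isBounded ?_ ?_
    · exact (isClosed_eq ((hpow _ continuous_fst).add (hpow _ continuous_snd))
        continuous_const).inter (isClosed_le continuous_const (hpow _ (by fun_prop)))
    · refine (Metric.isBounded_closedBall (x := (0 : E × E)) (r := 1)).subset fun x hx => ?_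
      rw [mem_closedBall_zero_iff, Prod.norm_def]
      exact max_le (hle _ _ hx.1) (hle x.2 x.1 (by rw [add_comm]; exact hx.1))
  obtain ⟨m, hm, hmS⟩ : ∃ m : ℝ, 0 < m ∧ ∀ x ∈ S, m ≤ (‖x.1‖ ^ p + ‖x.2‖ ^ p) / 2 -
      ‖(1 / 2 : ℝ) • (x.1 + x.2)‖ ^ p := by
    refine hS.exists_forall_le' hcont.continuousOn fun x hx => ?_
    have hne : x.1 ≠ x.2 := by
      intro h
      have := hx.2
      rw [h, sub_self, norm_zero, Real.zero_rpow hp0.ne'] at this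
      linarith
    have := norm_midpoint_rpow_lt hp hne
    linarith
  have hK : 0 < (2 : ℝ) ^ p / m := by positivity
  -- On normalized pairs `‖a - b‖ᵖ ≤ 2ᵖ`, so this `K` times a gap of at least `m` dominates `‖a -
  -- b‖ᵖ`.
  refine ⟨(2 : ℝ) ^ p / m, hK, ?_⟩
  have key : ∀ a b : E, ‖a‖ ^ p + ‖b‖ ^ p = 1 →
      ‖a - b‖ ^ p + (2 : ℝ) ^ p / m * ‖(1 / 2 : ℝ) • (a + b)‖ ^ p ≤
        (ε + (2 : ℝ) ^ p / m / 2) * (‖a‖ ^ p + ‖b‖ ^ p) := by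
    intro a b hab
    have h0 := norm_midpoint_rpow_le hp.le a b
    by_cases h : ε ≤ ‖a - b‖ ^ p
    · have h1 := hmS (a, b) ⟨hab, h⟩
      have h2 : ‖a - b‖ ^ p ≤ (2 : ℝ) ^ p := by
        refine Real.rpow_le_rpow (norm_nonneg _) ?_ hp0.le
        have := norm_sub_le a b
        have := hle a b hab
        have := hle b a (by rw [add_comm]; exact hab)
        linarith
      have h3 : (2 : ℝ) ^ p / m * m ≤ (2 : ℝ) ^ p / m * ((‖a‖ ^ p + ‖b‖ ^ p) / 2 -
          ‖(1 / 2 : ℝ) • (a + b)‖ ^ p) := by gcongr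
      rw [div_mul_cancel₀ _ hm.ne', mul_sub] at h3
      have h4 : 0 ≤ ε * (‖a‖ ^ p + ‖b‖ ^ p) := by rw [hab]; linarith
      linarith
    · have h3 := mul_le_mul_of_nonneg_left h0 hK.le
      rw [hab] at h3 ⊢
      linarith
  intro a b
  rcases (by positivity : 0 ≤ ‖a‖ ^ p + ‖b‖ ^ p).eq_or_lt with h | h
  · have h1 : ‖a‖ ^ p = 0 := by
      have := Real.rpow_nonneg (norm_nonneg a) p
      have := Real.rpow_nonneg (norm_nonneg b) p
      linarith
    have h2 : ‖b‖ ^ p = 0 := by linarith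
    rw [Real.rpow_eq_zero (norm_nonneg _) hp0.ne', norm_eq_zero] at h1 h2
    simp [h1, h2, Real.zero_rpow hp0.ne']
  · set t : ℝ := (‖a‖ ^ p + ‖b‖ ^ p) ^ (1 / p)
    have ht : 0 < t := Real.rpow_pos_of_pos h _
    have htp : t ^ p = ‖a‖ ^ p + ‖b‖ ^ p := by
      rw [← Real.rpow_mul h.le, one_div, inv_mul_cancel₀ hp0.ne', Real.rpow_one]
    have hs : ∀ x : E, ‖t⁻¹ • x‖ ^ p = (t ^ p)⁻¹ * ‖x‖ ^ p := by
      intro x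
      rw [norm_smul, Real.mul_rpow (norm_nonneg _) (norm_nonneg _), Real.norm_of_nonneg
        (inv_nonneg.2 ht.le), Real.inv_rpow ht.le]
    have htp0 : 0 < t ^ p := Real.rpow_pos_of_pos ht p
    have := key (t⁻¹ • a) (t⁻¹ • b) (by
      rw [hs, hs, ← mul_add, htp, inv_mul_cancel₀ h.ne'])
    rw [← smul_sub, ← smul_add, smul_comm, hs, hs, hs, hs, ← mul_add, mul_left_comm, ← mul_add,
      mul_left_comm] at this
    exact le_of_mul_le_mul_left this (inv_pos.2 htp0)

/-- The inequality is linear in the `p`-th powers and `K` does not depend on the vectors, so it can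
be summed over the coordinates. -/
theorem uniformConvexPow_lp {Λ : Type*} {p : ℝ} [Fact (1 ≤ ENNReal.ofReal p)] (hp : 0 < p)
    (h : UniformConvexPow p E) : UniformConvexPow p (lp (fun _ : Λ => E) (ENNReal.ofReal p)) := by
  intro ε hε
  obtain ⟨K, hK, hKE⟩ := h ε hε
  refine ⟨K, hK, fun a b => ?_⟩
  have hp' : (ENNReal.ofReal p).toReal = p := ENNReal.toReal_ofReal hp.le
  have hs : ∀ x : lp (fun _ : Λ => E) (ENNReal.ofReal p), HasSum (fun l => ‖x l‖ ^ p) (‖x‖ ^ p) := by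
    intro x
    have := lp.hasSum_norm (by rw [hp']; exact hp) x
    rwa [hp'] at this
  exact hasSum_le (fun l => hKE (a l) (b l))
    ((hs (a - b)).add ((hs ((1 / 2 : ℝ) • (a + b))).mul_left K))
    (((hs a).add (hs b)).mul_left (ε + K / 2))

end UniformConvexity

/-! ### Approximate minimum-norm solutions in uniformly convex spaces -/

section AbstractTikhonov

variable {X Y H : Type*} [AddCommGroup X] [NormedAddCommGroup Y]
  [NormedAddCommGroup H] {p : ℝ} {Φ : X →+ Y} {f : X →+ H} {C : ℝ} {v : H} {u₀ : X}

theorem tendsto_map_of_tendsto {ι : Type*} {l : Filter ι} {x : ι → X} {y : X}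
    (hf : ∀ x, ‖f x‖ ≤ C * ‖Φ x‖) (h : Tendsto (fun i => Φ (x i)) l (𝓝 (Φ y))) :
    Tendsto (fun i => f (x i)) l (𝓝 (f y)) := by
  rw [tendsto_iff_norm_sub_tendsto_zero] at h ⊢
  refine squeeze_zero (fun _ => norm_nonneg _) (fun i => ?_) (by simpa using h.const_mul C)
  simpa using hf (x i - y)

variable [NormedSpace ℝ Y]

/-- The terms `K R` on the two sides of the convexity inequality cancel, leaving `‖a - b‖ᵖ ≤ 2 ε (R
+ η) + 2 K η`. The choices of `ε` and `η` below bound the two summands by `τᵖ/2` and `τᵖ/4`. -/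
theorem UniformConvexPow.exists_bound (hp : 0 < p) (hY : UniformConvexPow p Y) (R : ℝ)
    (hR : 0 ≤ R) {τ : ℝ} (hτ : 0 < τ) :
    ∃ η : ℝ, 0 < η ∧ ∀ a b : Y, ‖a‖ ^ p ≤ R + η → ‖b‖ ^ p ≤ R + η →
      R - η ≤ ‖(1 / 2 : ℝ) • (a + b)‖ ^ p → ‖a - b‖ < τ := by
  have hτp : 0 < τ ^ p := Real.rpow_pos_of_pos hτ p
  obtain ⟨K, hK, hKY⟩ := hY (τ ^ p / (4 * (R + 1))) (by positivity)
  set ε := τ ^ p / (4 * (R + 1)) with hε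
  have hε0 : 0 < ε := by positivity
  refine ⟨min 1 (τ ^ p / (8 * K)), by positivity, fun a b ha hb hab => ?_⟩
  set η := min 1 (τ ^ p / (8 * K))
  have hη1 : η ≤ 1 := min_le_left _ _
  have hη2 : K * η ≤ τ ^ p / 8 := by
    calc K * η ≤ K * (τ ^ p / (8 * K)) := by gcongr; exact min_le_right _ _
      _ = τ ^ p / 8 := by field_simp
  have hε2 : ε * (R + 1) = τ ^ p / 4 := by rw [hε]; field_simp
  have h1 : (ε + K / 2) * (‖a‖ ^ p + ‖b‖ ^ p) ≤ (ε + K / 2) * (2 * (R + η)) := by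
    gcongr
    linarith
  have h2 : K * (R - η) ≤ K * ‖(1 / 2 : ℝ) • (a + b)‖ ^ p := by gcongr
  have h3 : ε * (R + η) ≤ ε * (R + 1) := by gcongr
  have h4 := hKY a b
  have h5 : ‖a - b‖ ^ p < τ ^ p := by nlinarith
  exact lt_of_not_ge fun h => not_lt.2 (Real.rpow_le_rpow hτ.le h hp.le) h5

theorem map_half {Φ : X →+ Y} {x z : X} (h : x = z + z) : Φ z = (1 / 2 : ℝ) • Φ x := by
  rw [h, map_add, ← two_smul ℝ, smul_smul]
  norm_num

/-- Balls are midpoint convex. As `X` is only an additive group, a midpoint is any `z` with `x + y =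
z + z`. -/
theorem norm_midpoint_sub_le [NormedSpace ℝ H] {x y z : X} (h : x + y = z + z) {ε : ℝ}
    (hx : ‖f x - v‖ ≤ ε) (hy : ‖f y - v‖ ≤ ε) : ‖f z - v‖ ≤ ε := by
  have h1 : f z - v = (1 / 2 : ℝ) • ((f x - v) + (f y - v)) := by
    rw [map_half h, map_add]
    module
  rw [h1, norm_smul]
  have := norm_add_le (f x - v) (f y - v)
  norm_num
  linarith

/-- Near-solutions of `f w = v` have almost at least the norm of a minimum-norm solution. -/
theorem exists_le_norm_of_norm_sub_le [NormedSpace ℝ H] (hp : 0 < p) (hY : UniformConvexPow p Y)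
    (hX : ∀ x : X, Even x) (hf : ∀ x, ‖f x‖ ≤ C * ‖Φ x‖)
    (hΦ : ∀ x : ℕ → X, CauchySeq (fun n => Φ (x n)) →
      ∃ y, Tendsto (fun n => Φ (x n)) atTop (𝓝 (Φ y)))
    (hmin : ∀ w, f w = v → ‖Φ u₀‖ ≤ ‖Φ w‖) {η : ℝ} (hη : 0 < η) :
    ∃ ε : ℝ, 0 < ε ∧ ∀ w, ‖f w - v‖ ≤ ε → ‖Φ u₀‖ ^ p - η ≤ ‖Φ w‖ ^ p := by
  by_contra! hcon
  have hpos : ∀ n : ℕ, (0 : ℝ) < 1 / ((n : ℝ) + 1) := fun n => Nat.one_div_pos_of_nat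
  set A : ℕ → Set X := fun n => {w | ‖f w - v‖ ≤ 1 / ((n : ℝ) + 1)} with hA
  have hAanti : ∀ n m, n ≤ m → A m ⊆ A n := fun n m h w hw =>
    Set.mem_ofPred.2 ((Set.mem_ofPred.1 hw).trans (Nat.one_div_le_one_div h))
  -- The infima over the shrinking sets `A n` increase to a limit `R`, still at most `‖Φ u₀‖ᵖ - η`.
  set r : ℕ → ℝ := fun n => sInf ((fun w => ‖Φ w‖ ^ p) '' A n) with hr
  have hbdd : ∀ n, BddBelow ((fun w => ‖Φ w‖ ^ p) '' A n) := fun n =>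
    ⟨0, by rintro _ ⟨w, -, rfl⟩; positivity⟩
  have hrle : ∀ n w, w ∈ A n → r n ≤ ‖Φ w‖ ^ p := fun n w hw =>
    csInf_le (hbdd n) (Set.mem_image_of_mem _ hw)
  have hne : ∀ n, (A n).Nonempty := fun n => by
    obtain ⟨w, hw, -⟩ := hcon _ (hpos n)
    exact ⟨w, hw⟩
  have hrub : ∀ n, r n ≤ ‖Φ u₀‖ ^ p - η := fun n => by
    obtain ⟨w, hw, hw'⟩ := hcon _ (hpos n)
    exact (hrle n w hw).trans hw'.le
  have hr0 : ∀ n, 0 ≤ r n := fun n => le_csInf ((hne n).image _) (by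
    rintro _ ⟨w, -, rfl⟩; positivity)
  have hrmono : Monotone r := fun n m h =>
    csInf_le_csInf (hbdd n) ((hne m).image _) (Set.image_mono (hAanti n m h))
  have hrbdd : BddAbove (Set.range r) := ⟨_, by rintro _ ⟨n, rfl⟩; exact hrub n⟩
  have hrlim := tendsto_atTop_ciSup hrmono hrbdd
  set R := ⨆ n, r n
  have hrR : ∀ n, r n ≤ R := fun n => le_ciSup hrbdd n
  have hR : R ≤ ‖Φ u₀‖ ^ p - η := ciSup_le hrub
  have hx : ∀ n, ∃ x ∈ A n, ‖Φ x‖ ^ p < r n + 1 / ((n : ℝ) + 1) := fun n => by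
    obtain ⟨_, ⟨w, hw, rfl⟩, hlt⟩ := exists_lt_of_csInf_lt ((hne n).image fun w => ‖Φ w‖ ^ p)
      (lt_add_of_pos_right (r n) (hpos n))
    exact ⟨w, hw, hlt⟩
  choose x hxA hxr using hx
  have hcauchy : CauchySeq fun n => Φ (x n) := by
    rw [Metric.cauchySeq_iff']
    intro τ hτ
    obtain ⟨η', hη', hkey⟩ := hY.exists_bound hp R ((hr0 0).trans (hrR 0)) hτ
    have h1 : ∀ᶠ n in atTop, R - η' < r n := hrlim.eventually_const_lt (by linarith)
    have h2 : ∀ᶠ n : ℕ in atTop, 1 / ((n : ℝ) + 1) < η' :=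
      tendsto_one_div_add_atTop_nhds_zero_nat.eventually_lt_const hη'
    obtain ⟨N, hN1, hN2⟩ := (h1.and h2).exists
    refine ⟨N, fun n hn => ?_⟩
    have hub : ∀ n, N ≤ n → ‖Φ (x n)‖ ^ p ≤ R + η' := fun n hn => by
      have h3 : 1 / ((n : ℝ) + 1) ≤ 1 / ((N : ℝ) + 1) := Nat.one_div_le_one_div hn
      linarith [hxr n, hrR n]
    -- The midpoint lies in `A N`, hence has `p`-th power norm at least `r N > R - η'`.
    obtain ⟨z, hz⟩ := hX (x n + x N)
    rw [dist_eq_norm]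
    refine hkey _ _ (hub n hn) (hub N le_rfl) ?_
    rw [← map_add, ← map_half hz]
    have hzA : z ∈ A N := norm_midpoint_sub_le hz (hAanti N n hn (hxA n)) (hxA N)
    linarith [hrle N z hzA]
  obtain ⟨y, hy⟩ := hΦ x hcauchy
  have hfy : f y = v := by
    refine tendsto_nhds_unique (tendsto_map_of_tendsto hf hy) ?_
    rw [tendsto_iff_norm_sub_tendsto_zero]
    exact squeeze_zero (fun _ => norm_nonneg _) (fun n => hxA n)
      tendsto_one_div_add_atTop_nhds_zero_nat
  have hyR : ‖Φ y‖ ^ p ≤ R := by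
    have h1 : Tendsto (fun n => ‖Φ (x n)‖ ^ p) atTop (𝓝 (‖Φ y‖ ^ p)) :=
      hy.norm.rpow_const (Or.inr hp.le)
    have h2 := hrlim.add (tendsto_one_div_add_atTop_nhds_zero_nat (𝕜 := ℝ))
    rw [add_zero] at h2
    exact le_of_tendsto_of_tendsto' h1 h2 fun n => (hxr n).le
  have := Real.rpow_le_rpow (norm_nonneg _) (hmin y hfy) hp.le
  linarith

/-- Near-solutions of `f w = v` with asymptotically minimal norm converge to the minimum-norm
solution. -/
theorem tendsto_norm_sub_of_norm_le [NormedSpace ℝ H] (hp : 0 < p) (hY : UniformConvexPow p Y)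
    (hX : ∀ x : X, Even x) (hf : ∀ x, ‖f x‖ ≤ C * ‖Φ x‖)
    (hΦ : ∀ x : ℕ → X, CauchySeq (fun n => Φ (x n)) →
      ∃ y, Tendsto (fun n => Φ (x n)) atTop (𝓝 (Φ y)))
    (hu₀ : f u₀ = v) (hmin : ∀ w, f w = v → ‖Φ u₀‖ ≤ ‖Φ w‖)
    {ι : Type*} {l : Filter ι} {x : ι → X} (hfx : Tendsto (fun i => f (x i)) l (𝓝 v))
    (hx : ∀ η : ℝ, 0 < η → ∀ᶠ i in l, ‖Φ (x i)‖ ^ p ≤ ‖Φ u₀‖ ^ p + η) :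
    Tendsto (fun i => Φ (x i)) l (𝓝 (Φ u₀)) := by
  rw [Metric.tendsto_nhds]
  intro τ hτ
  obtain ⟨η, hη, hkey⟩ := hY.exists_bound hp (‖Φ u₀‖ ^ p) (by positivity) hτ
  obtain ⟨ε, hε, hlow⟩ := exists_le_norm_of_norm_sub_le (u₀ := u₀) hp hY hX hf hΦ hmin hη
  filter_upwards [hx η hη, Metric.tendsto_nhds.1 hfx ε hε] with i hi hi'
  obtain ⟨z, hz⟩ := hX (x i + u₀)
  rw [dist_eq_norm] at hi' ⊢
  refine hkey _ _ hi (by linarith) ?_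
  rw [← map_add, ← map_half hz]
  exact hlow z (norm_midpoint_sub_le hz hi'.le (by simpa [hu₀] using hε.le))

end AbstractTikhonov

/-! ### High-pass filters on Schwartz functions -/

section HighPass

open FourierTransform

variable {d : ℕ}

/-- The symbol `1 - χ(a ξ)` of a high-pass filter. -/
def highPass (d : ℕ) (a : ℝ) (ξ : Space d) : ℂ := 1 - (cutoff d (a • ξ) : ℂ)

theorem contDiff_ofReal_cutoff (d : ℕ) : ContDiff ℝ ∞ fun ξ : Space d => (cutoff d ξ : ℂ) :=
  Complex.ofRealCLM.contDiff.comp (cutoff d).contDiff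

theorem contDiff_highPass_one (d : ℕ) : ContDiff ℝ ∞ (highPass d 1) := by
  have : highPass d 1 = fun ξ => 1 - (cutoff d ξ : ℂ) := by
    ext ξ
    simp [highPass]
  rw [this]
  exact contDiff_const.sub (contDiff_ofReal_cutoff d)

theorem highPass_eq_comp (d : ℕ) (a : ℝ) : highPass d a = fun ξ => highPass d 1 (a • ξ) := by
  ext ξ
  simp [highPass]

theorem hasTemperateGrowth_highPass (d : ℕ) {a : ℝ} (ha : a ≠ 0) :
    (highPass d a).HasTemperateGrowth :=
  (Function.HasTemperateGrowth.const (1 : ℂ)).sub (Function.Complex.hasTemperateGrowth_ofReal.comp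
    ((hasCompactSupport_cutoff_smul d ha).hasTemperateGrowth (contDiff_cutoff_smul d a)))

theorem exists_norm_iteratedFDeriv_highPass_one_le (d n : ℕ) :
    ∃ B : ℝ, ∀ ξ, ‖iteratedFDeriv ℝ n (highPass d 1) ξ‖ ≤ B := by
  have hc : HasCompactSupport fun ξ : Space d => (cutoff d ξ : ℂ) :=
    (cutoff d).hasCompactSupport.comp_left (g := fun t : ℝ => (t : ℂ)) Complex.ofReal_zero
  obtain ⟨B, hB⟩ := (hc.iteratedFDeriv (𝕜 := ℝ) n).exists_bound_of_continuous
    ((contDiff_ofReal_cutoff d).continuous_iteratedFDeriv (by exact_mod_cast le_top))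
  refine ⟨1 + B, fun ξ => ?_⟩
  have h1 : highPass d 1 = (fun _ => (1 : ℂ)) - fun ξ : Space d => (cutoff d ξ : ℂ) := by
    ext ξ
    simp [highPass]
  rw [h1, iteratedFDeriv_sub_apply contDiff_const.contDiffAt
    ((contDiff_ofReal_cutoff d).of_le (by exact_mod_cast le_top)).contDiffAt]
  refine (norm_sub_le _ _).trans (add_le_add ?_ (hB ξ))
  rcases n.eq_zero_or_pos with rfl | hn
  · simp
  · simp [iteratedFDeriv_const_of_ne hn.ne']

/-- The symbol vanishes where `a ‖ξ‖ < 1`; elsewhere `(a ‖ξ‖) ^ N ≥ 1` can be inserted for free.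
Scaling costs `a ^ n ≤ 2 ^ n`; the range `a ≤ 2` covers every filter used later. -/
theorem exists_norm_iteratedFDeriv_highPass_le (d n N : ℕ) :
    ∃ B : ℝ, 0 ≤ B ∧ ∀ a : ℝ, 0 < a → a ≤ 2 → ∀ ξ,
      ‖iteratedFDeriv ℝ n (highPass d a) ξ‖ ≤ B * (a * ‖ξ‖) ^ N := by
  obtain ⟨B, hB⟩ := exists_norm_iteratedFDeriv_highPass_one_le d n
  have hB0 : 0 ≤ B := (norm_nonneg _).trans (hB 0)
  refine ⟨2 ^ n * B, by positivity, fun a ha ha2 ξ => ?_⟩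
  rw [highPass_eq_comp, iteratedFDeriv_comp_const_smul a
    ((contDiff_highPass_one d).of_le (by exact_mod_cast le_top))]
  by_cases h : a * ‖ξ‖ < 1
  · have h0 : highPass d 1 =ᶠ[𝓝 (a • ξ)] 0 := by
      filter_upwards [(cutoff d).eventuallyEq_one_of_mem_ball (x := a • ξ) (by
        simpa [norm_smul, abs_of_pos ha, cutoff] using h)] with η hη
      simp [highPass, hη]
    have h1 : iteratedFDeriv ℝ n (highPass d 1) (a • ξ) = 0 := by
      rw [(h0.iteratedFDeriv ℝ n).eq_of_nhds]
      simp
    simp only [h1, smul_zero, norm_zero]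
    positivity
  · rw [norm_smul, norm_pow, Real.norm_of_nonneg ha.le]
    have h1 : 1 ≤ (a * ‖ξ‖) ^ N := one_le_pow₀ (not_lt.1 h)
    calc a ^ n * ‖iteratedFDeriv ℝ n (highPass d 1) (a • ξ)‖ ≤ 2 ^ n * B := by
          gcongr
          exact hB _
      _ ≤ 2 ^ n * B * (a * ‖ξ‖) ^ N := le_mul_of_one_le_right (by positivity) h1

theorem continuous_seminorm_sum {ι : Type*} {s : Finset ι} {P : ι → Seminorm ℂ 𝓢(Space d, ℂ)}
    (hP : ∀ i ∈ s, Continuous (P i)) : Continuous (∑ i ∈ s, P i : Seminorm ℂ 𝓢(Space d, ℂ)) :=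
  Finset.sum_induction P (fun Q => Continuous Q) (fun _ _ h h' => h.add h') continuous_zero hP

theorem continuous_schwartz_seminorm (k n : ℕ) :
    Continuous (SchwartzMap.seminorm ℂ k n : Seminorm ℂ 𝓢(Space d, ℂ)) :=
  (schwartz_withSeminorms ℂ (Space d) ℂ).continuous_seminorm (k, n)

/-- By Leibniz' rule; the factor `‖ξ‖ ^ N` from the symbol bound is absorbed by a Schwartz seminorm
of weight `k + N`. -/
theorem exists_schwartz_seminorm_highPass_le (k n N : ℕ) :
    ∃ P : Seminorm ℂ 𝓢(Space d, ℂ), Continuous P ∧ ∀ a : ℝ, 0 < a → a ≤ 2 → ∀ ψ : 𝓢(Space d, ℂ),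
      SchwartzMap.seminorm ℂ k n (SchwartzMap.smulLeftCLM ℂ (highPass d a) ψ) ≤ a ^ N * P ψ := by
  choose B hB0 hB using fun i => exists_norm_iteratedFDeriv_highPass_le d i N
  refine ⟨∑ i ∈ Finset.range (n + 1), ((n.choose i : ℝ≥0) * (B i).toNNReal) •
    SchwartzMap.seminorm ℂ (k + N) (n - i), continuous_seminorm_sum fun i _ =>
      (continuous_schwartz_seminorm (k + N) (n - i)).const_smul _, fun a ha ha2 ψ => ?_⟩
  have hg := hasTemperateGrowth_highPass d ha.ne'
  refine SchwartzMap.seminorm_le_bound ℂ k n _ (mul_nonneg (by positivity) (apply_nonneg _ _))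
    fun ξ => ?_
  rw [SchwartzMap.smulLeftCLM_apply hg]
  have h1 := norm_iteratedFDeriv_smul_le (𝕜 := ℝ) hg.1 (ψ.smooth ⊤) ξ (n := n)
    (by exact_mod_cast le_top)
  refine (mul_le_mul_of_nonneg_left h1 (by positivity)).trans ?_
  rw [_root_.sum_apply, Finset.mul_sum, Finset.mul_sum]
  refine Finset.sum_le_sum fun i _ => ?_
  have h2 := hB i a ha ha2 ξ
  have h3 := SchwartzMap.le_seminorm ℂ (k + N) (n - i) ψ ξ
  rw [_root_.smul_apply, NNReal.smul_def, smul_eq_mul]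
  push_cast
  rw [Real.coe_toNNReal _ (hB0 i)]
  calc ‖ξ‖ ^ k * ((n.choose i : ℝ) * ‖iteratedFDeriv ℝ i (highPass d a) ξ‖ *
        ‖iteratedFDeriv ℝ (n - i) ψ ξ‖)
      ≤ ‖ξ‖ ^ k * ((n.choose i : ℝ) * (B i * (a * ‖ξ‖) ^ N) *
        ‖iteratedFDeriv ℝ (n - i) ψ ξ‖) := by gcongr
    _ = a ^ N * (n.choose i * B i * (‖ξ‖ ^ (k + N) * ‖iteratedFDeriv ℝ (n - i) ψ ξ‖)) := by ring
    _ ≤ _ := by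
      have := hB0 i
      gcongr

theorem exists_seminorm_highPass_le {Q : Seminorm ℂ 𝓢(Space d, ℂ)} (hQ : Continuous Q) (N : ℕ) :
    ∃ P : Seminorm ℂ 𝓢(Space d, ℂ), Continuous P ∧ ∀ a : ℝ, 0 < a → a ≤ 2 → ∀ ψ : 𝓢(Space d, ℂ),
      Q (SchwartzMap.smulLeftCLM ℂ (highPass d a) ψ) ≤ a ^ N * P ψ := by
  obtain ⟨s, C, -, hs⟩ := Seminorm.bound_of_continuous (schwartz_withSeminorms ℂ (Space d) ℂ) Q hQ
  choose P hP hPle using fun m : ℕ × ℕ => exists_schwartz_seminorm_highPass_le (d := d) m.1 m.2 N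
  refine ⟨C • ∑ m ∈ s, P m, (continuous_seminorm_sum fun m _ => hP m).const_smul C,
    fun a ha ha2 ψ => ?_⟩
  refine (hs _).trans ?_
  rw [_root_.smul_apply, _root_.smul_apply, NNReal.smul_def, smul_eq_mul, NNReal.smul_def,
    smul_eq_mul, mul_left_comm, _root_.sum_apply, Finset.mul_sum]
  gcongr
  refine (Seminorm.finset_sup_le_sum (schwartzSeminormFamily ℂ (Space d) ℂ) s _).trans ?_
  rw [_root_.sum_apply]
  exact Finset.sum_le_sum fun m _ => hPle m a ha ha2 ψ

/-- The high-pass filter `φ ↦ 𝓕 ((1 - χ(a ·)) 𝓕⁻¹ φ)` on Schwartz functions. -/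
def highPassFilter (a : ℝ) (φ : 𝓢(Space d, ℂ)) : 𝓢(Space d, ℂ) :=
  𝓕 (SchwartzMap.smulLeftCLM ℂ (highPass d a) (𝓕⁻ φ))

theorem exists_seminorm_highPassFilter_le {Q : Seminorm ℂ 𝓢(Space d, ℂ)} (hQ : Continuous Q)
    (N : ℕ) : ∃ P : Seminorm ℂ 𝓢(Space d, ℂ), Continuous P ∧ ∀ a : ℝ, 0 < a → a ≤ 2 →
      ∀ φ : 𝓢(Space d, ℂ), Q (highPassFilter a φ) ≤ a ^ N * P φ := by
  obtain ⟨P, hP, hPle⟩ := exists_seminorm_highPass_le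
    (Q := Q.comp (fourierCLM ℂ 𝓢(Space d, ℂ) : 𝓢(Space d, ℂ) →ₗ[ℂ] 𝓢(Space d, ℂ)))
    (hQ.comp (fourierCLM ℂ 𝓢(Space d, ℂ)).continuous) N
  exact ⟨P.comp (fourierInvCLM ℂ 𝓢(Space d, ℂ) : 𝓢(Space d, ℂ) →ₗ[ℂ] 𝓢(Space d, ℂ)),
    hP.comp (fourierInvCLM ℂ 𝓢(Space d, ℂ)).continuous, fun a ha ha2 φ => hPle a ha ha2 _⟩

theorem exists_seminorm_eLpNorm_le (q : ℝ≥0∞) :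
    ∃ P : Seminorm ℂ 𝓢(Space d, ℂ), Continuous P ∧ ∀ φ : 𝓢(Space d, ℂ),
      eLpNorm φ q volume ≤ ENNReal.ofReal (P φ) := by
  obtain ⟨k, C, hC⟩ := SchwartzMap.eLpNorm_le_seminorm (E := Space d) ℂ ℂ q volume
  refine ⟨C • ∑ m ∈ Finset.Iic (k, 0), schwartzSeminormFamily ℂ (Space d) ℂ m,
    (continuous_seminorm_sum fun m _ => continuous_schwartz_seminorm m.1 m.2).const_smul C,
    fun φ => (hC φ).trans ?_⟩
  rw [_root_.smul_apply, NNReal.smul_def, smul_eq_mul,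
    ENNReal.ofReal_mul (p := (C : ℝ)) C.2, ENNReal.ofReal_coe_nnreal]
  gcongr
  exact Seminorm.finset_sup_le_sum (schwartzSeminormFamily ℂ (Space d) ℂ) _ φ

end HighPass

/-! ### The embedding of Besov spaces into the tempered distributions -/

section BesovEmbedding

open FourierTransform

variable {d : ℕ}

/-- Hölder's inequality for each density, followed by the infimum. Finiteness of the norm supplies a
density when the `q`-norm of `φ` is zero. -/
theorem enorm_apply_le_distLpNorm_mul {p q : ℝ≥0∞} [p.HolderConjugate q] {T : 𝓢'(Space d, ℂ)}
    (hT : distLpNorm p T < ⊤) (φ : 𝓢(Space d, ℂ)) :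
    ‖T φ‖ₑ ≤ distLpNorm p T * eLpNorm φ q volume := by
  have key : ∀ g, IsLpDensity p T g → ‖T φ‖ₑ ≤ eLpNorm g p volume * eLpNorm φ q volume := by
    intro g hg
    rw [hg.2 φ]
    refine (enorm_integral_le_lintegral_enorm _).trans ?_
    rw [← eLpNorm_one_eq_lintegral_enorm]
    have := eLpNorm_smul_le_mul_eLpNorm (𝕜 := ℂ) (E := ℂ) (p := p) (q := q) (r := 1)
      (f := fun x => φ x) (φ := g)
      φ.continuous.aestronglyMeasurable hg.1.1
    have h1 : (fun x => φ x * g x) = g • fun x => φ x := by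
      ext x
      exact mul_comm _ _
    rw [h1]
    exact this
  obtain ⟨g, hT'⟩ := iInf_lt_iff.1 hT
  obtain ⟨hg, -⟩ := iInf_lt_iff.1 hT'
  rcases eq_or_ne (eLpNorm φ q volume) 0 with h | h
  · have := key g hg
    rw [h, mul_zero] at this
    exact this.trans bot_le
  · have htop : eLpNorm φ q volume ≠ ⊤ := (φ.memLp q volume).2.ne
    unfold distLpNorm
    rw [ENNReal.iInf_mul_of_ne h htop]
    refine le_iInf fun g => ?_
    rw [ENNReal.iInf_mul_of_ne h htop]
    exact le_iInf fun hg => key g hg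

theorem ofReal_mul_distLpNorm_le_besovNormWhole {s p : ℝ} (hp : 0 < p) (U : 𝓢'(Space d, ℂ))
    (j : ℕ) : ENNReal.ofReal ((2 : ℝ) ^ ((j : ℝ) * s)) *
      distLpNorm (ENNReal.ofReal p) (lpBlock j U) ≤ besovNormWhole s p U := by
  unfold besovNormWhole
  rw [one_div, ENNReal.le_rpow_inv_iff hp]
  exact ENNReal.le_tsum j

theorem distLpNorm_lpBlock_le {s p : ℝ} (hp : 0 < p) (U : 𝓢'(Space d, ℂ)) (j : ℕ) :
    distLpNorm (ENNReal.ofReal p) (lpBlock j U) ≤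
      ENNReal.ofReal ((2 : ℝ) ^ (-((j : ℝ) * s))) * besovNormWhole s p U := by
  refine le_trans (le_of_eq ?_)
    (mul_le_mul_right (ofReal_mul_distLpNorm_le_besovNormWhole hp U j) _)
  rw [← mul_assoc, ← ENNReal.ofReal_mul (by positivity), ← Real.rpow_add two_pos]
  simp

theorem fourier_sub_schwartz (φ ψ : 𝓢(Space d, ℂ)) : 𝓕 (φ - ψ) = 𝓕 φ - 𝓕 ψ :=
  map_sub (fourierCLM ℂ 𝓢(Space d, ℂ)) φ ψ

theorem lpBlock_zero_apply (U : 𝓢'(Space d, ℂ)) (φ : 𝓢(Space d, ℂ)) :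
    lpBlock 0 U φ = U φ - U (highPassFilter 1 φ) := by
  have h1 : SchwartzMap.smulLeftCLM ℂ (fun ξ => (dyadicSymbol d 0 ξ : ℂ)) (𝓕⁻ φ) =
      𝓕⁻ φ - SchwartzMap.smulLeftCLM ℂ (highPass d 1) (𝓕⁻ φ) := by
    ext ξ
    rw [sub_apply, SchwartzMap.smulLeftCLM_apply_apply (hasTemperateGrowth_dyadicSymbol d 0),
      SchwartzMap.smulLeftCLM_apply_apply (hasTemperateGrowth_highPass d one_ne_zero)]
    simp [highPass, dyadicSymbol]
    ring
  have h2 : lpBlock 0 U φ =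
      U (𝓕 (SchwartzMap.smulLeftCLM ℂ (fun ξ => (dyadicSymbol d 0 ξ : ℂ)) (𝓕⁻ φ))) := rfl
  rw [h2, h1, highPassFilter, fourier_sub_schwartz, FourierTransform.fourier_fourierInv_eq,
    map_sub]

theorem lpBlock_succ_apply (j : ℕ) (U : 𝓢'(Space d, ℂ)) (φ : 𝓢(Space d, ℂ)) :
    lpBlock (j + 1) U φ =
      U (highPassFilter ((2⁻¹ : ℝ) ^ j) φ) - U (highPassFilter ((2⁻¹ : ℝ) ^ (j + 1)) φ) := by
  have h1 : SchwartzMap.smulLeftCLM ℂ (fun ξ => (dyadicSymbol d (j + 1) ξ : ℂ)) (𝓕⁻ φ) =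
      SchwartzMap.smulLeftCLM ℂ (highPass d ((2⁻¹ : ℝ) ^ j)) (𝓕⁻ φ) -
      SchwartzMap.smulLeftCLM ℂ (highPass d ((2⁻¹ : ℝ) ^ (j + 1))) (𝓕⁻ φ) := by
    ext ξ
    rw [sub_apply, SchwartzMap.smulLeftCLM_apply_apply (hasTemperateGrowth_dyadicSymbol d _),
      SchwartzMap.smulLeftCLM_apply_apply (hasTemperateGrowth_highPass d (by positivity)),
      SchwartzMap.smulLeftCLM_apply_apply (hasTemperateGrowth_highPass d (by positivity))]
    simp only [highPass, dyadicSymbol, smul_eq_mul]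
    push_cast
    ring
  have h2 : lpBlock (j + 1) U φ =
      U (𝓕 (SchwartzMap.smulLeftCLM ℂ (fun ξ => (dyadicSymbol d (j + 1) ξ : ℂ)) (𝓕⁻ φ))) := rfl
  rw [h2, h1, highPassFilter, highPassFilter, fourier_sub_schwartz, map_sub]

/-- Each dyadic symbol is a difference of consecutive high-pass symbols, so the sum telescopes. -/
theorem sum_lpBlock_apply (U : 𝓢'(Space d, ℂ)) (φ : 𝓢(Space d, ℂ)) (J : ℕ) :
    ∑ j ∈ Finset.range (J + 1), lpBlock j U φ = U φ - U (highPassFilter ((2⁻¹ : ℝ) ^ J) φ) := by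
  induction J with
  | zero => simp [lpBlock_zero_apply]
  | succ J ih =>
    rw [Finset.sum_range_succ, ih, lpBlock_succ_apply]
    ring

/-- The symbol of the block vanishes where `‖2⁻ʲ ξ‖ < 1`, and the high-pass symbol is `1` on the
rest. Thus `φ` may be replaced by its filtered version, which is small in every seminorm. -/
theorem lpBlock_succ_highPassFilter (j : ℕ) (U : 𝓢'(Space d, ℂ)) (φ : 𝓢(Space d, ℂ)) :
    lpBlock (j + 1) U (highPassFilter (2 * (2⁻¹ : ℝ) ^ j) φ) = lpBlock (j + 1) U φ := by
  have hg := hasTemperateGrowth_dyadicSymbol d (j + 1)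
  have hh := hasTemperateGrowth_highPass d (a := 2 * (2⁻¹ : ℝ) ^ j) (by positivity)
  have h1 : SchwartzMap.smulLeftCLM ℂ (fun ξ => (dyadicSymbol d (j + 1) ξ : ℂ))
      (SchwartzMap.smulLeftCLM ℂ (highPass d (2 * (2⁻¹ : ℝ) ^ j)) (𝓕⁻ φ)) =
      SchwartzMap.smulLeftCLM ℂ (fun ξ => (dyadicSymbol d (j + 1) ξ : ℂ)) (𝓕⁻ φ) := by
    ext ξ
    rw [SchwartzMap.smulLeftCLM_apply_apply hg, SchwartzMap.smulLeftCLM_apply_apply hg,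
      SchwartzMap.smulLeftCLM_apply_apply hh]
    simp only [highPass, dyadicSymbol, smul_eq_mul]
    by_cases h : 1 ≤ ‖(2⁻¹ : ℝ) ^ j • ξ‖
    · have h2 : cutoff d ((2 * (2⁻¹ : ℝ) ^ j) • ξ) = 0 := by
        refine (cutoff d).zero_of_le_dist ?_
        rw [dist_zero_right, mul_smul, norm_smul]
        simpa [cutoff] using h
      rw [h2]
      simp
    · have h2 : cutoff d ((2⁻¹ : ℝ) ^ j • ξ) = 1 := by
        refine (cutoff d).one_of_mem_closedBall ?_
        simpa [cutoff] using (not_le.1 h).le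
      have h3 : cutoff d ((2⁻¹ : ℝ) ^ (j + 1) • ξ) = 1 := by
        refine (cutoff d).one_of_mem_closedBall ?_
        rw [mem_closedBall_zero_iff, pow_succ', mul_smul, norm_smul]
        change ‖(2⁻¹ : ℝ)‖ * _ ≤ 1
        rw [Real.norm_of_nonneg (by norm_num)]
        linarith [norm_nonneg ((2⁻¹ : ℝ) ^ j • ξ)]
      rw [h2, h3]
      simp
  have h2 : ∀ φ, lpBlock (j + 1) U φ =
    U (𝓕 (SchwartzMap.smulLeftCLM ℂ (fun ξ => (dyadicSymbol d (j + 1) ξ : ℂ)) (𝓕⁻ φ))) :=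
      fun _ => rfl
  rw [h2, h2, highPassFilter, FourierTransform.fourierInv_fourier_eq, h1]

theorem tendsto_sum_lpBlock_apply (U : 𝓢'(Space d, ℂ)) (φ : 𝓢(Space d, ℂ)) :
    Tendsto (fun J => ∑ j ∈ Finset.range (J + 1), lpBlock j U φ) atTop (𝓝 (U φ)) := by
  obtain ⟨P, -, hP⟩ := exists_seminorm_highPassFilter_le
    (Q := (normSeminorm ℂ ℂ).comp (U : 𝓢(Space d, ℂ) →ₗ[ℂ] ℂ))
    (continuous_norm.comp (map_continuous U)) 1
  simp_rw [sum_lpBlock_apply]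
  suffices h : Tendsto (fun J : ℕ => U (highPassFilter ((2⁻¹ : ℝ) ^ J) φ)) atTop (𝓝 0) by
    simpa using h.const_sub (U φ)
  refine squeeze_zero_norm (a := fun J : ℕ => (2⁻¹ : ℝ) ^ J * P φ) (fun J => ?_) ?_
  · have := hP ((2⁻¹ : ℝ) ^ J) (by positivity)
      ((pow_le_one₀ (by norm_num) (by norm_num)).trans one_le_two) φ
    rwa [pow_one] at this
  · simpa using (tendsto_pow_atTop_nhds_zero_of_lt_one (r := (2⁻¹ : ℝ)) (by norm_num)
      (by norm_num)).mul_const (P φ)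

theorem enorm_apply_le_tsum_lpBlock (U : 𝓢'(Space d, ℂ)) (φ : 𝓢(Space d, ℂ)) :
    ‖U φ‖ₑ ≤ ∑' j, ‖lpBlock j U φ‖ₑ :=
  le_of_tendsto (tendsto_sum_lpBlock_apply U φ).enorm (Eventually.of_forall fun _ =>
    (enorm_sum_le _ _).trans (ENNReal.sum_le_tsum _))

/-- With `s + N ≥ 1`, the decay of the filtered test function beats the weight `2^{-(j+1)s}` even
for negative `s`, leaving a geometric series. -/
theorem rpow_mul_pow_le {s : ℝ} {N : ℕ} (hN : 1 - s ≤ N) (j : ℕ) :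
    (2 : ℝ) ^ (-(((j + 1 : ℕ) : ℝ) * s)) * (2 * (2⁻¹ : ℝ) ^ j) ^ N ≤
      2 ^ (2 * N) * (2⁻¹ : ℝ) ^ (j + 1) := by
  have e1 : (2 * (2⁻¹ : ℝ) ^ j) ^ N = (2 : ℝ) ^ ((N : ℝ) - j * N) := by
    rw [mul_pow, ← pow_mul, inv_pow, Real.rpow_sub two_pos, ← Nat.cast_mul, Real.rpow_natCast,
      Real.rpow_natCast, div_eq_mul_inv]
  have e2 : 2 ^ (2 * N) * (2⁻¹ : ℝ) ^ (j + 1) = (2 : ℝ) ^ (2 * (N : ℝ) - (j + 1)) := by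
    rw [inv_pow, Real.rpow_sub two_pos, div_eq_mul_inv]
    norm_cast
  rw [e1, e2, ← Real.rpow_add two_pos]
  refine Real.rpow_le_rpow_of_exponent_le one_le_two ?_
  push_cast
  nlinarith [mul_le_mul_of_nonneg_left hN (by positivity : (0 : ℝ) ≤ (j : ℝ) + 1)]

/-- The Besov space `B^s_{p,p}(ℝᵈ)` embeds continuously into the tempered distributions. -/
theorem exists_seminorm_enorm_apply_le_besovNormWhole (d : ℕ) (s : ℝ) {p : ℝ} (hp : 1 ≤ p) :
    ∃ P : Seminorm ℂ 𝓢(Space d, ℂ), Continuous P ∧ ∀ (U : 𝓢'(Space d, ℂ)) (φ : 𝓢(Space d, ℂ)),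
      besovNormWhole s p U < ⊤ → ‖U φ‖ₑ ≤ besovNormWhole s p U * ENNReal.ofReal (P φ) := by
  have hp0 : 0 < p := by linarith
  have hp' : 1 ≤ ENNReal.ofReal p := by simpa using ENNReal.ofReal_le_ofReal hp
  have := ENNReal.HolderConjugate.inv_one_sub_inv' hp'
  set q := (1 - (ENNReal.ofReal p)⁻¹)⁻¹
  obtain ⟨Q, hQ, hQle⟩ := exists_seminorm_eLpNorm_le (d := d) q
  obtain ⟨N, hN⟩ := exists_nat_ge (1 - s)
  obtain ⟨P, hP, hPle⟩ := exists_seminorm_highPassFilter_le hQ N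
  -- `Q` controls the block `j = 0`; the other blocks contribute `2 ^ (2 * N) • P` times a geometric
  -- series with sum `1`.
  refine ⟨Q + (2 ^ (2 * N) : ℝ≥0) • P, hQ.add (hP.const_smul _), fun U φ hU => ?_⟩
  set B := besovNormWhole s p U
  have hdist : ∀ j, distLpNorm (ENNReal.ofReal p) (lpBlock j U) < ⊤ := fun j =>
    (distLpNorm_lpBlock_le (s := s) hp0 U j).trans_lt
      (ENNReal.mul_lt_top ENNReal.ofReal_lt_top hU)
  have h0 : ‖lpBlock 0 U φ‖ₑ ≤ B * ENNReal.ofReal (Q φ) := by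
    refine (enorm_apply_le_distLpNorm_mul (q := q) (hdist 0) φ).trans ?_
    gcongr
    · simpa using distLpNorm_lpBlock_le (s := s) hp0 U 0
    · exact hQle φ
  have hsucc : ∀ j, ‖lpBlock (j + 1) U φ‖ₑ ≤
      B * ENNReal.ofReal (2 ^ (2 * N) * P φ) * 2⁻¹ ^ (j + 1) := by
    intro j
    rw [← lpBlock_succ_highPassFilter]
    have ha2 : 2 * (2⁻¹ : ℝ) ^ j ≤ 2 := by
      have : (2⁻¹ : ℝ) ^ j ≤ 1 := pow_le_one₀ (by norm_num) (by norm_num)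
      linarith
    have hP0 : 0 ≤ P φ := apply_nonneg P φ
    calc _ ≤ _ := enorm_apply_le_distLpNorm_mul (q := q) (hdist (j + 1)) _
      _ ≤ ENNReal.ofReal ((2 : ℝ) ^ (-(((j + 1 : ℕ) : ℝ) * s))) * B *
          ENNReal.ofReal ((2 * (2⁻¹ : ℝ) ^ j) ^ N * P φ) := by
        gcongr
        · exact distLpNorm_lpBlock_le hp0 U (j + 1)
        · exact (hQle _).trans (ENNReal.ofReal_le_ofReal (hPle _ (by positivity) ha2 φ))
      _ = B * ENNReal.ofReal ((2 : ℝ) ^ (-(((j + 1 : ℕ) : ℝ) * s)) *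
          (2 * (2⁻¹ : ℝ) ^ j) ^ N * P φ) := by
        rw [mul_comm _ B, mul_assoc, ← ENNReal.ofReal_mul (by positivity), mul_assoc]
      _ ≤ B * ENNReal.ofReal (2 ^ (2 * N) * (2⁻¹ : ℝ) ^ (j + 1) * P φ) := by
        exact mul_le_mul_right (ENNReal.ofReal_le_ofReal
          (mul_le_mul_of_nonneg_right (rpow_mul_pow_le hN j) hP0)) _
      _ = _ := by
        rw [mul_right_comm, ENNReal.ofReal_mul (q := (2⁻¹ : ℝ) ^ (j + 1)) (by positivity),
          ← mul_assoc, ENNReal.ofReal_pow (by norm_num), ENNReal.ofReal_inv_of_pos two_pos,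
          ENNReal.ofReal_ofNat]
  refine (enorm_apply_le_tsum_lpBlock U φ).trans ?_
  rw [tsum_eq_zero_add' ENNReal.summable]
  refine (add_le_add h0 (ENNReal.tsum_le_tsum hsucc)).trans (le_of_eq ?_)
  rw [ENNReal.tsum_mul_left, ENNReal.tsum_geometric_add_one, ENNReal.one_sub_inv_two, inv_inv,
    ENNReal.inv_mul_cancel (by norm_num) (by norm_num), mul_one, ← mul_add,
    ← ENNReal.ofReal_add (apply_nonneg Q φ) (mul_nonneg (by positivity) (apply_nonneg P φ))]
  rfl

end BesovEmbedding

/-! ### Completeness of Besov spaces -/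

/-- Minkowski's inequality for double series. -/
theorem tsum_rpow_tsum_le {ι κ : Type*} {p : ℝ} (hp : 1 ≤ p) (a : ι → κ → ℝ≥0∞) :
    (∑' j, (∑' n, a n j) ^ p) ^ (1 / p) ≤ ∑' n, (∑' j, a n j ^ p) ^ (1 / p) := by
  have hp0 : 0 < p := by linarith
  have hfin : ∀ (s : Finset κ) (t : Finset ι), (∑ j ∈ s, (∑ n ∈ t, a n j) ^ p) ^ (1 / p) ≤
      ∑ n ∈ t, (∑ j ∈ s, a n j ^ p) ^ (1 / p) := by
    classical
    intro s t
    induction t using Finset.induction_on with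
    | empty => simp [hp0]
    | insert n t hn ih =>
      simp only [Finset.sum_insert hn]
      exact (ENNReal.Lp_add_le s (a n) (fun j => ∑ n ∈ t, a n j) hp).trans (by gcongr)
  rw [one_div, ENNReal.rpow_inv_le_iff hp0, ENNReal.tsum_eq_iSup_sum]
  refine iSup_le fun s => ?_
  rw [← ENNReal.rpow_inv_le_iff hp0]
  have hlim : Tendsto (fun t : Finset ι => (∑ j ∈ s, (∑ n ∈ t, a n j) ^ p) ^ p⁻¹) atTop
      (𝓝 ((∑ j ∈ s, (∑' n, a n j) ^ p) ^ p⁻¹)) :=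
    (ENNReal.continuous_rpow_const.tendsto _).comp (tendsto_finsetSum s fun j _ =>
      (ENNReal.continuous_rpow_const.tendsto _).comp ENNReal.summable.hasSum)
  refine le_of_tendsto' hlim fun t => ?_
  have h1 := hfin s t
  rw [one_div] at h1
  refine h1.trans ((ENNReal.sum_le_tsum t).trans (ENNReal.tsum_le_tsum fun n => ?_))
  gcongr
  exact ENNReal.sum_le_tsum s

section Complete

variable {d : ℕ}

/-- Densities that attain the norms up to summable errors form an absolutely convergent series in
the complete space `Lᵖ`; since `Lᵖ` embeds continuously in the tempered distributions, its sum is a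
density of `S`. -/
theorem distLpNorm_le_tsum {p : ℝ≥0∞} (hp : 1 ≤ p) {T : ℕ → 𝓢'(Space d, ℂ)}
    {S : 𝓢'(Space d, ℂ)} (hS : ∀ φ, HasSum (fun n => T n φ) (S φ)) :
    distLpNorm p S ≤ ∑' n, distLpNorm p (T n) := by
  have hp' : Fact (1 ≤ p) := ⟨hp⟩
  refine ENNReal.le_of_forall_pos_le_add fun ε hε hfin => ?_
  obtain ⟨ε', hε', hεsum⟩ := ENNReal.exists_pos_sum_of_countable'
    (ENNReal.coe_pos.2 hε).ne' ℕ
  have hex : ∀ n, ∃ g, IsLpDensity p (T n) g ∧ eLpNorm g p volume < distLpNorm p (T n) + ε' n := by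
    intro n
    have h1 : distLpNorm p (T n) < distLpNorm p (T n) + ε' n :=
      ENNReal.lt_add_right (ne_top_of_le_ne_top hfin.ne (ENNReal.le_tsum n)) (hε' n).ne'
    obtain ⟨g, h2⟩ := iInf_lt_iff.1 h1
    obtain ⟨hg, h3⟩ := iInf_lt_iff.1 h2
    exact ⟨g, hg, h3⟩
  choose g hg hgle using hex
  set G : ℕ → Lp ℂ p (volume : Measure (Space d)) := fun n => (hg n).1.toLp (g n)
  have hGle : ∑' n, ‖G n‖ₑ ≤ (∑' n, distLpNorm p (T n)) + ε := by
    calc ∑' n, ‖G n‖ₑ ≤ ∑' n, (distLpNorm p (T n) + ε' n) := by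
          refine ENNReal.tsum_le_tsum fun n => ?_
          rw [Lp.enorm_toLp]
          exact (hgle n).le
      _ ≤ _ := by
          rw [ENNReal.tsum_add]
          gcongr
  have hsum : Summable G := Summable.of_enorm
    (ne_top_of_le_ne_top (ENNReal.add_ne_top.2 ⟨hfin.ne, ENNReal.coe_ne_top⟩) hGle)
  have hdens : IsLpDensity p S (∑' n, G n : Lp ℂ p (volume : Measure (Space d))) := by
    refine ⟨Lp.memLp _, fun φ => (hS φ).unique ?_⟩
    have h1 := (hsum.hasSum.mapL (Lp.toTemperedDistributionCLM ℂ
      (volume : Measure (Space d)) p)).mapL (PointwiseConvergenceCLM.evalCLM (RingHom.id ℂ) ℂ φ)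
    have heval : ∀ F : Lp ℂ p (volume : Measure (Space d)),
        PointwiseConvergenceCLM.evalCLM (RingHom.id ℂ) ℂ φ
          (Lp.toTemperedDistributionCLM ℂ (volume : Measure (Space d)) p F) =
        ∫ x, φ x * F x := fun F => Lp.toTemperedDistribution_apply F φ
    have hG : ∀ n, T n φ = ∫ x, φ x * G n x := by
      intro n
      rw [(hg n).2 φ]
      refine integral_congr_ae ?_
      filter_upwards [(hg n).1.coeFn_toLp] with x hx
      simp [G, hx]
    simp_rw [hG]
    simpa only [heval] using h1
  refine (iInf₂_le _ hdens).trans ?_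
  rw [← Lp.enorm_def]
  exact enorm_tsum_le_tsum_enorm.trans hGle

theorem besovNormWhole_le_tsum {s p : ℝ} (hp : 1 ≤ p) {U : ℕ → 𝓢'(Space d, ℂ)}
    {S : 𝓢'(Space d, ℂ)} (hS : ∀ φ, HasSum (fun n => U n φ) (S φ)) :
    besovNormWhole s p S ≤ ∑' n, besovNormWhole s p (U n) := by
  have hp' : 1 ≤ ENNReal.ofReal p := by simpa using ENNReal.ofReal_le_ofReal hp
  refine le_trans ?_ (tsum_rpow_tsum_le hp fun n (j : ℕ) => ENNReal.ofReal ((2 : ℝ) ^ ((j : ℝ) * s)) *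
    distLpNorm (ENNReal.ofReal p) (lpBlock j (U n)))
  unfold besovNormWhole
  refine ENNReal.rpow_le_rpow (ENNReal.tsum_le_tsum fun j => ?_) (by positivity)
  rw [ENNReal.tsum_mul_left]
  gcongr
  exact distLpNorm_le_tsum hp' fun φ => hS _

/-- The embedding into tempered distributions bounds all terms by one continuous seminorm times
their norms, so the pointwise sum exists and is continuous. -/
theorem exists_hasSum_of_tsum_besovNormWhole_lt_top {s p : ℝ} (hp : 1 ≤ p)
    {U : ℕ → 𝓢'(Space d, ℂ)} (hU : ∑' n, besovNormWhole s p (U n) < ⊤) :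
    ∃ S : 𝓢'(Space d, ℂ), ∀ φ, HasSum (fun n => U n φ) (S φ) := by
  obtain ⟨P, hP, hPle⟩ := exists_seminorm_enorm_apply_le_besovNormWhole d s hp
  have hUn : ∀ n, besovNormWhole s p (U n) < ⊤ := fun n => (ENNReal.le_tsum n).trans_lt hU
  have hle : ∀ φ, ∑' n, ‖U n φ‖ₑ ≤ (∑' n, besovNormWhole s p (U n)) * ENNReal.ofReal (P φ) := by
    intro φ
    rw [← ENNReal.tsum_mul_right]
    exact ENNReal.tsum_le_tsum fun n => hPle (U n) φ (hUn n)
  have hsum : ∀ φ, Summable fun n => U n φ := fun φ => Summable.of_enorm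
    ((hle φ).trans_lt (ENNReal.mul_lt_top hU ENNReal.ofReal_lt_top)).ne
  obtain ⟨t, C, -, hC⟩ := Seminorm.bound_of_continuous (schwartz_withSeminorms ℂ (Space d) ℂ) P hP
  refine ⟨ContinuousLinearMap.toPointwiseConvergenceCLM _ _ _ _ (SchwartzMap.mkCLMtoNormedSpace
    (σ := RingHom.id ℂ) (fun φ => ∑' n, U n φ) (fun φ ψ => ?_) (fun c φ => ?_)
    ⟨t, (∑' n, besovNormWhole s p (U n)).toReal * C, by positivity, fun φ => ?_⟩),
    fun φ => (hsum φ).hasSum⟩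
  · simp_rw [map_add]
    exact (hsum φ).tsum_add (hsum ψ)
  · simp_rw [map_smul]
    exact (hsum φ).tsum_const_smul c
  · have h1 := enorm_tsum_le_tsum_enorm.trans (hle φ)
    have h2 := ENNReal.toReal_mono (ENNReal.mul_lt_top hU ENNReal.ofReal_lt_top).ne h1
    rw [toReal_enorm, ENNReal.toReal_mul, ENNReal.toReal_ofReal (apply_nonneg P φ)] at h2
    rw [mul_assoc]
    exact h2.trans (mul_le_mul_of_nonneg_left (hC φ) ENNReal.toReal_nonneg)

end Complete

/-! ### Completeness on `Ω`, by lifting to `ℝᵈ` and restricting -/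

section CompleteDomain

open ContDiffMapSupportedIn

variable {𝕜 : Type*} [RCLike 𝕜] {d : ℕ} {Ω : Opens (Space d)}

@[simp]
theorem testToSchwartz_apply (φ : 𝓓(Ω, ℝ)) (x : Space d) : testToSchwartz φ x = ((φ x : ℝ) : ℂ) :=
  rfl

theorem testToSchwartz_add (φ ψ : 𝓓(Ω, ℝ)) :
    testToSchwartz (φ + ψ) = testToSchwartz φ + testToSchwartz ψ := by
  ext x
  simp

theorem testToSchwartz_smul (c : ℝ) (φ : 𝓓(Ω, ℝ)) :
    testToSchwartz (c • φ) = c • testToSchwartz φ := by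
  ext x
  simp

theorem continuous_testToSchwartz_ofSupportedIn {K : Compacts (Space d)}
    (hK : (K : Set (Space d)) ⊆ Ω) :
    Continuous fun f : 𝓓^{⊤}_{K}(Space d, ℝ) =>
      testToSchwartz (TestFunction.ofSupportedIn hK f : 𝓓(Ω, ℝ)) := by
  let A : 𝓓^{⊤}_{K}(Space d, ℝ) →ₗ[ℝ] 𝓢(Space d, ℂ) :=
    { toFun := fun f => testToSchwartz (TestFunction.ofSupportedIn hK f : 𝓓(Ω, ℝ))
      map_add' := fun f g =>
        testToSchwartz_add (TestFunction.ofSupportedIn hK f : 𝓓(Ω, ℝ)) (TestFunction.ofSupportedIn hK g)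
      map_smul' := fun c f =>
        testToSchwartz_smul c (TestFunction.ofSupportedIn hK f : 𝓓(Ω, ℝ)) }
  change Continuous A
  obtain ⟨R, hR⟩ := K.isCompact.isBounded.exists_norm_le
  refine WithSeminorms.continuous_of_isBounded (ContDiffMapSupportedIn.withSeminorms ℝ _ _ _ _)
    (schwartz_withSeminorms ℝ (Space d) ℂ) A fun m => ⟨{m.2}, (max R 0).toNNReal ^ m.1, fun f => ?_⟩
  refine SchwartzMap.seminorm_le_bound ℝ m.1 m.2 (A f) (by positivity) fun x => ?_
  rw [Finset.sup_singleton, _root_.smul_apply, NNReal.smul_def, smul_eq_mul]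
  push_cast
  rw [Real.coe_toNNReal _ (le_max_right R 0)]
  have h1 : ‖iteratedFDeriv ℝ m.2 (A f) x‖ = ‖iteratedFDeriv ℝ m.2 f x‖ :=
    Complex.ofRealLI.norm_iteratedFDeriv_comp_left f.contDiff.contDiffAt (by exact_mod_cast le_top)
  rw [h1]
  by_cases hx : x ∈ K
  · gcongr
    · exact (hR x hx).trans (le_max_left _ _)
    · exact norm_iteratedFDeriv_apply_le_seminorm_top ℝ
  · have h0 : iteratedFDeriv ℝ m.2 f x = 0 := f.iteratedFDeriv_zero_on_compl hx
    rw [h0, norm_zero, mul_zero]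
    positivity

/-- The restriction to `Ω` of a tempered distribution. -/
def restrictDist (𝕜 : Type*) [RCLike 𝕜] (Ω : Opens (Space d)) (U : 𝓢'(Space d, ℂ)) : 𝓓'(Ω, 𝕜) :=
  let A : 𝓓(Ω, ℝ) →L[ℝ] 𝕜 := TestFunction.mkCLM ℝ
    (fun φ => RCLike.map ℂ 𝕜 (U (testToSchwartz φ)))
    (fun φ ψ => by rw [testToSchwartz_add, map_add, map_add])
    (fun c φ => by
      have h : U (c • testToSchwartz φ) = c • U (testToSchwartz φ) :=
        map_real_smul U.toAddMonoidHom (map_continuous U) c _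
      rw [testToSchwartz_smul, h, map_smul])
    (fun _ hK => (RCLike.map ℂ 𝕜).continuous.comp
      ((map_continuous U).comp (continuous_testToSchwartz_ofSupportedIn hK)))
  ⟨A.toLinearMap, A.continuous⟩

theorem map_map_complex (z : 𝕜) : RCLike.map ℂ 𝕜 (RCLike.map 𝕜 ℂ z) = z := by
  simp [RCLike.map_apply]

theorem exists_hasSum_of_tsum_lt_top {s p : ℝ} (hp : 1 ≤ p) {T : ℕ → 𝓓'(Ω, 𝕜)} {b : ℕ → ℝ≥0∞}
    (hT : ∀ n, besovNorm s p (T n) < b n) (hb : ∑' n, b n < ⊤) :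
    ∃ S : 𝓓'(Ω, 𝕜), (∀ φ, HasSum (fun n => T n φ) (S φ)) ∧ besovNorm s p S ≤ ∑' n, b n := by
  have hex : ∀ n, ∃ U : 𝓢'(Space d, ℂ), IsRestriction U (T n) ∧ besovNormWhole s p U < b n := by
    intro n
    obtain ⟨U, h1⟩ := iInf_lt_iff.1 (hT n)
    obtain ⟨hU, h2⟩ := iInf_lt_iff.1 h1
    exact ⟨U, hU, h2⟩
  choose U hUT hUb using hex
  have hle : ∑' n, besovNormWhole s p (U n) ≤ ∑' n, b n :=
    ENNReal.tsum_le_tsum fun n => (hUb n).le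
  obtain ⟨W, hW⟩ := exists_hasSum_of_tsum_besovNormWhole_lt_top hp (hle.trans_lt hb)
  have hsum : ∀ φ, HasSum (fun n => T n φ) (restrictDist 𝕜 Ω W φ) := by
    intro φ
    have h1 := (hW (testToSchwartz φ)).map (RCLike.map ℂ 𝕜) (RCLike.map ℂ 𝕜).continuous
    have h2 : (RCLike.map ℂ 𝕜) ∘ (fun n => U n (testToSchwartz φ)) = fun n => T n φ := by
      ext n
      rw [Function.comp_apply, ← hUT n φ, map_map_complex]
    rwa [h2] at h1
  refine ⟨restrictDist 𝕜 Ω W, hsum, (iInf₂_le W fun φ => ?_).trans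
    ((besovNormWhole_le_tsum hp hW).trans hle)⟩
  -- For `𝕜 = ℝ`, `restrictDist` discards imaginary parts. Nothing is lost here: on real test
  -- functions `W` is a limit of values coming from `𝕜`.
  have h1 := (hsum φ).map (RCLike.map 𝕜 ℂ) (RCLike.map 𝕜 ℂ).continuous
  have h2 : (RCLike.map 𝕜 ℂ) ∘ (fun n => T n φ) = fun n => U n (testToSchwartz φ) := by
    ext n
    exact hUT n φ
  rw [h2] at h1
  exact h1.unique (hW (testToSchwartz φ))

/-- Besov spaces on domains are complete. -/
theorem exists_tendsto_besovNorm_sub {s p : ℝ} (hp : 1 ≤ p) {x : ℕ → 𝓓'(Ω, 𝕜)} {b : ℕ → ℝ≥0∞}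
    (hx : ∀ n, besovNorm s p (x (n + 1) - x n) < b n) (hb : ∑' n, b n ≠ ⊤) :
    ∃ y : 𝓓'(Ω, 𝕜), Tendsto (fun n => besovNorm s p (y - x n)) atTop (𝓝 0) := by
  have htail : ∀ m, ∑' n, b (n + m) < ⊤ := fun m =>
    (ENNReal.tsum_comp_le_tsum_of_injective (add_left_injective m) b).trans_lt hb.lt_top
  have hex : ∀ m, ∃ S : 𝓓'(Ω, 𝕜), (∀ φ, HasSum (fun n => x (n + m + 1) φ - x (n + m) φ) (S φ)) ∧
      besovNorm s p S ≤ ∑' n, b (n + m) := fun m =>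
    exists_hasSum_of_tsum_lt_top hp (T := fun n => x (n + m + 1) - x (n + m))
      (fun n => hx (n + m)) (htail m)
  choose S hS hSb using hex
  have hlim : ∀ m φ, Tendsto (fun n => x n φ) atTop (𝓝 (S m φ + x m φ)) := by
    intro m φ
    have h1 := ((hS m φ).tendsto_sum_nat).add_const (x m φ)
    have h2 : ∀ n, ∑ i ∈ Finset.range n, (x (i + m + 1) φ - x (i + m) φ) + x m φ =
        x (n + m) φ := by
      intro n
      have h3 := Finset.sum_range_sub (fun i => x (i + m) φ) n
      simp only [zero_add] at h3
      simp only [add_right_comm _ 1 m] at h3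
      rw [h3, sub_add_cancel]
    simp only [h2] at h1
    exact (tendsto_add_atTop_iff_nat m).1 h1
  refine ⟨S 0 + x 0, ?_⟩
  -- `S m` is the sum of the increments from index `m` on, so its norm is at most a tail of `∑ b n`.
  have heq : ∀ m, S 0 + x 0 - x m = S m := by
    intro m
    refine DFunLike.ext _ _ fun φ => ?_
    have h1 := tendsto_nhds_unique (hlim 0 φ) (hlim m φ)
    change S 0 φ + x 0 φ - x m φ = S m φ
    rw [h1, add_sub_cancel_right]
  simp_rw [heq]
  exact tendsto_of_tendsto_of_tendsto_of_le_of_le tendsto_const_nhds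
    (ENNReal.tendsto_sum_nat_add b hb) (fun _ => bot_le) hSb

end CompleteDomain

/-! ### The wavelet norm as an `ℓᵖ` norm -/

section Wavelet

variable {𝕜 : Type*} [RCLike 𝕜] {d : ℕ} {Ω : Opens (Space d)} {s p : ℝ} {hp : 1 ≤ p} {Λ : Type*}

namespace BesovWaveletBasis

/-- The sum `∑_λ 2^{p (s + d (1/2 - 1/p)) |λ|} |u_λ|^p`. -/
def energy (W : BesovWaveletBasis 𝕜 Ω s p hp Λ) (u : besovSpace 𝕜 Ω s p hp) : ℝ≥0∞ :=
  ∑' l : Λ, ENNReal.ofReal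
    ((2 : ℝ) ^ (p * (s + d * (1 / 2 - 1 / p)) * (W.scale l : ℝ))) * ‖W.coeff l u‖ₑ ^ p

theorem energy_lt_top (W : BesovWaveletBasis 𝕜 Ω s p hp Λ) (u : besovSpace 𝕜 Ω s p hp) :
    W.energy u < ⊤ := by
  obtain ⟨c, C, -, -, h⟩ := W.norm_equiv
  exact (h u).2.trans_lt (ENNReal.mul_lt_top ENNReal.coe_lt_top
    (ENNReal.rpow_lt_top_of_nonneg (by linarith) u.2.ne))

/-- The weighted wavelet coefficients `2^{(s + d (1/2 - 1/p)) |λ|} u_λ`. -/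
def weightedCoeff (W : BesovWaveletBasis 𝕜 Ω s p hp Λ) (u : besovSpace 𝕜 Ω s p hp) (l : Λ) : 𝕜 :=
  (2 : ℝ) ^ ((s + d * (1 / 2 - 1 / p)) * (W.scale l : ℝ)) • W.coeff l u

theorem enorm_weightedCoeff_rpow (W : BesovWaveletBasis 𝕜 Ω s p hp Λ)
    (u : besovSpace 𝕜 Ω s p hp) (l : Λ) : ‖W.weightedCoeff u l‖ₑ ^ p = ENNReal.ofReal
      ((2 : ℝ) ^ (p * (s + d * (1 / 2 - 1 / p)) * (W.scale l : ℝ))) * ‖W.coeff l u‖ₑ ^ p := by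
  have hp0 : 0 ≤ p := by linarith
  rw [weightedCoeff, enorm_smul, ENNReal.mul_rpow_of_nonneg _ _ hp0,
    Real.enorm_of_nonneg (by positivity), ENNReal.ofReal_rpow_of_nonneg (by positivity) hp0,
    ← Real.rpow_mul two_pos.le]
  congr 3
  ring

theorem summable_weightedCoeff (W : BesovWaveletBasis 𝕜 Ω s p hp Λ)
    (u : besovSpace 𝕜 Ω s p hp) : Summable fun l => ‖W.weightedCoeff u l‖ ^ p := by
  have h := ENNReal.summable_toReal (f := fun l => ‖W.weightedCoeff u l‖ₑ ^ p) (by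
    simp_rw [enorm_weightedCoeff_rpow]
    exact (W.energy_lt_top u).ne)
  simpa [← ENNReal.toReal_rpow] using h

/-- The weighted wavelet coefficients as a map from the Besov space to `ℓᵖ`. -/
def toLp (W : BesovWaveletBasis 𝕜 Ω s p hp Λ) :
    besovSpace 𝕜 Ω s p hp →+ lp (fun _ : Λ => 𝕜) (ENNReal.ofReal p) where
  toFun u := ⟨W.weightedCoeff u, memℓp_gen (by
    rw [ENNReal.toReal_ofReal (by linarith)]
    exact W.summable_weightedCoeff u)⟩
  map_zero' := by
    ext l
    simp [weightedCoeff]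
  map_add' u w := by
    ext l
    change (2 : ℝ) ^ _ • W.coeff l (u + w) = (2 : ℝ) ^ _ • W.coeff l u + (2 : ℝ) ^ _ • W.coeff l w
    rw [map_add, smul_add]

theorem mem_of_besovNorm_sub_lt_top {y z : 𝓓'(Ω, 𝕜)} (h : besovNorm s p (y - z) < ⊤)
    (hz : z ∈ besovSpace 𝕜 Ω s p hp) : y ∈ besovSpace 𝕜 Ω s p hp := by
  have h1 : y - z ∈ besovSpace 𝕜 Ω s p hp := h
  have h2 := add_mem h1 hz
  rwa [sub_add_cancel] at h2

variable [Fact (1 ≤ ENNReal.ofReal p)]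

theorem enorm_toLp_rpow (W : BesovWaveletBasis 𝕜 Ω s p hp Λ) (u : besovSpace 𝕜 Ω s p hp) :
    ‖W.toLp u‖ₑ ^ p = W.energy u := by
  have hp0 : 0 < p := by linarith
  have hp' : (ENNReal.ofReal p).toReal = p := ENNReal.toReal_ofReal hp0.le
  have h1 := lp.norm_rpow_eq_tsum (by rw [hp']; exact hp0) (W.toLp u)
  rw [hp'] at h1
  have h2 : ‖W.toLp u‖ₑ ^ p = ENNReal.ofReal (‖W.toLp u‖ ^ p) := by
    rw [← ofReal_norm, ENNReal.ofReal_rpow_of_nonneg (norm_nonneg _) hp0.le]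
  have h3 : ∑' l, ‖W.toLp u l‖ ^ p = ∑' l, ‖W.weightedCoeff u l‖ ^ p := rfl
  rw [h2, h1, h3, ENNReal.ofReal_tsum_of_nonneg (fun _ => by positivity)
    (W.summable_weightedCoeff u)]
  refine tsum_congr fun l => ?_
  rw [← enorm_weightedCoeff_rpow, ← ENNReal.ofReal_rpow_of_nonneg (norm_nonneg _) hp0.le,
    ofReal_norm]

theorem norm_eq_enorm_toLp (W : BesovWaveletBasis 𝕜 Ω s p hp Λ) (u : besovSpace 𝕜 Ω s p hp) :
    W.norm (u : 𝓓'(Ω, 𝕜)) = ‖W.toLp u‖ₑ := by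
  have hp0 : 0 < p := by linarith
  rw [BesovWaveletBasis.norm, dif_pos u.2]
  change W.energy u ^ (1 / p) = _
  rw [← enorm_toLp_rpow, one_div, ENNReal.rpow_rpow_inv hp0.ne']

theorem exists_besovNorm_le (W : BesovWaveletBasis 𝕜 Ω s p hp Λ) : ∃ C : ℝ≥0,
    ∀ u : besovSpace 𝕜 Ω s p hp, besovNorm s p (u : 𝓓'(Ω, 𝕜)) ≤ C * ‖W.toLp u‖ₑ := by
  have hp0 : 0 < p := by linarith
  obtain ⟨c, _, hc, _, h⟩ := W.norm_equiv
  refine ⟨c⁻¹ ^ (1 / p), fun u => ?_⟩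
  have h1 : c * besovNorm s p (u : 𝓓'(Ω, 𝕜)) ^ p ≤ ‖W.toLp u‖ₑ ^ p := by
    rw [enorm_toLp_rpow]
    exact (h u).1
  rw [← ENNReal.rpow_le_rpow_iff hp0, ENNReal.mul_rpow_of_nonneg _ _ hp0.le,
    ENNReal.coe_rpow_of_nonneg _ (by positivity), ← ENNReal.rpow_mul, one_div,
    inv_mul_cancel₀ hp0.ne', ENNReal.rpow_one, ENNReal.coe_inv hc.ne', mul_comm,
    ← div_eq_mul_inv, ENNReal.le_div_iff_mul_le (Or.inl (by simpa using hc.ne'))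
    (Or.inl ENNReal.coe_ne_top), mul_comm]
  exact h1

theorem exists_enorm_toLp_le (W : BesovWaveletBasis 𝕜 Ω s p hp Λ) : ∃ C : ℝ≥0,
    ∀ u : besovSpace 𝕜 Ω s p hp, ‖W.toLp u‖ₑ ≤ C * besovNorm s p (u : 𝓓'(Ω, 𝕜)) := by
  have hp0 : 0 < p := by linarith
  obtain ⟨_, C, _, hC, h⟩ := W.norm_equiv
  refine ⟨C ^ (1 / p), fun u => ?_⟩
  rw [← ENNReal.rpow_le_rpow_iff hp0, ENNReal.mul_rpow_of_nonneg _ _ hp0.le,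
    ENNReal.coe_rpow_of_nonneg _ (by positivity), ← ENNReal.rpow_mul, one_div,
    inv_mul_cancel₀ hp0.ne', ENNReal.rpow_one, enorm_toLp_rpow]
  exact (h u).2

theorem exists_tendsto_toLp_of_edist_lt (W : BesovWaveletBasis 𝕜 Ω s p hp Λ)
    {x : ℕ → besovSpace 𝕜 Ω s p hp}
    (hx : ∀ n, edist (W.toLp (x (n + 1))) (W.toLp (x n)) < 2⁻¹ ^ n) :
    ∃ y, Tendsto (fun n => W.toLp (x n)) atTop (𝓝 (W.toLp y)) := by
  obtain ⟨C₁, hC₁⟩ := W.exists_besovNorm_le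
  obtain ⟨C₂, hC₂⟩ := W.exists_enorm_toLp_le
  -- The added `1` makes the bound strict, as needed to pick extensions of norm below it.
  have hlt : ∀ n, besovNorm s p ((x (n + 1) : 𝓓'(Ω, 𝕜)) - (x n : 𝓓'(Ω, 𝕜))) <
      (C₁ + 1) * 2⁻¹ ^ n := by
    intro n
    have h1 : ‖W.toLp (x (n + 1) - x n)‖ₑ < 2⁻¹ ^ n := by
      rw [map_sub, ← edist_eq_enorm_sub]
      exact hx n
    have h2 := hC₁ (x (n + 1) - x n)
    refine lt_of_le_of_lt (h2.trans (mul_le_mul_right h1.le _)) ?_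
    rw [add_mul, one_mul]
    exact ENNReal.lt_add_right (by finiteness) (ENNReal.pow_pos (by simp) n).ne'
  obtain ⟨y, hy⟩ := exists_tendsto_besovNorm_sub hp (x := fun n => (x n : 𝓓'(Ω, 𝕜))) hlt (by
    rw [ENNReal.tsum_mul_left, ENNReal.tsum_geometric, ENNReal.one_sub_inv_two, inv_inv]
    finiteness)
  obtain ⟨k, hk⟩ := (hy.eventually_lt_const ENNReal.zero_lt_top).exists
  have hymem : y ∈ besovSpace 𝕜 Ω s p hp := mem_of_besovNorm_sub_lt_top hk (x k).2
  refine ⟨⟨y, hymem⟩, ?_⟩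
  rw [tendsto_iff_edist_tendsto_0]
  have h0 : Tendsto (fun n => C₂ * besovNorm s p (y - (x n : 𝓓'(Ω, 𝕜)))) atTop (𝓝 0) := by
    simpa using ENNReal.Tendsto.const_mul hy (Or.inr ENNReal.coe_ne_top)
  refine tendsto_of_tendsto_of_tendsto_of_le_of_le tendsto_const_nhds h0 (fun _ => bot_le)
    fun n => ?_
  have h1 := hC₂ (⟨y, hymem⟩ - x n)
  rw [map_sub, ← edist_eq_enorm_sub, edist_comm, Submodule.coe_sub] at h1
  exact h1

/-- The range of the coefficient map is closed; surjectivity onto `ℓᵖ` is not needed. A subsequence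
with geometrically small increments suffices. -/
theorem exists_tendsto_toLp (W : BesovWaveletBasis 𝕜 Ω s p hp Λ)
    {x : ℕ → besovSpace 𝕜 Ω s p hp} (hx : CauchySeq fun n => W.toLp (x n)) :
    ∃ y, Tendsto (fun n => W.toLp (x n)) atTop (𝓝 (W.toLp y)) := by
  obtain ⟨φ, hφ, hφx⟩ := hx.subseq_mem (V := fun n : ℕ => {q | edist q.1 q.2 < 2⁻¹ ^ n})
    fun n => edist_mem_uniformity (ENNReal.pow_pos (by simp) n)
  obtain ⟨y, hy⟩ := W.exists_tendsto_toLp_of_edist_lt (x := x ∘ φ) hφx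
  exact ⟨y, tendsto_nhds_of_cauchySeq_of_subseq hx hφ.tendsto_atTop hy⟩

end BesovWaveletBasis

end Wavelet

/-! ### The Tikhonov functional on `B_R` and convergence of minimizers -/

section Convergence

variable {𝕜 : Type*} [RCLike 𝕜] {d : ℕ} {Ω : Opens (Space d)}
  {sD pD sR pR : ℝ} {hpD : 1 ≤ pD} {hpR : 1 ≤ pR} {Λ : Type*}

theorem BesovEmbeds.le (h : BesovEmbeds 𝕜 Ω sR pR sD pD) :
    besovSpace 𝕜 Ω sR pR hpR ≤ besovSpace 𝕜 Ω sD pD hpD := by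
  obtain ⟨C, hC⟩ := h
  exact fun T hT => (hC T hT).trans_lt (ENNReal.mul_lt_top ENNReal.coe_lt_top hT)

/-- Outside `B_R` the penalty is `∞`; positivity of `α` matters because `0 * ∞ = 0`. -/
theorem mem_besovSpace_of_tikhonov_lt_top {W : BesovWaveletBasis 𝕜 Ω sR pR hpR Λ}
    {F : besovSpace 𝕜 Ω sD pD hpD →ₗ[𝕜] L2 𝕜 Ω} {w : L2 𝕜 Ω} {α : ℝ} (hα : 0 < α)
    {x : besovSpace 𝕜 Ω sD pD hpD} (hx : tikhonov W F w α x < ⊤) :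
    (x : 𝓓'(Ω, 𝕜)) ∈ besovSpace 𝕜 Ω sR pR hpR := by
  by_contra h
  have h1 : W.norm (x : 𝓓'(Ω, 𝕜)) = ⊤ := dif_neg h
  have hp0 : 0 < pR := by linarith
  rw [tikhonov, h1, ENNReal.top_rpow_of_pos hp0, ENNReal.mul_top (by simpa using hα),
    add_top] at hx
  exact lt_irrefl _ hx

variable [Fact (1 ≤ ENNReal.ofReal pR)]

theorem tikhonov_inclusion (h : BesovEmbeds 𝕜 Ω sR pR sD pD)
    (W : BesovWaveletBasis 𝕜 Ω sR pR hpR Λ) (F : besovSpace 𝕜 Ω sD pD hpD →ₗ[𝕜] L2 𝕜 Ω)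
    (w : L2 𝕜 Ω) {α : ℝ} (hα : 0 ≤ α) (x : besovSpace 𝕜 Ω sR pR hpR) :
    tikhonov W F w α (Submodule.inclusion h.le x) = ENNReal.ofReal
      (‖F (Submodule.inclusion h.le x) - w‖ ^ 2 + α * ‖W.toLp x‖ ^ pR) := by
  have hp0 : 0 ≤ pR := by linarith
  rw [tikhonov, Submodule.coe_inclusion, W.norm_eq_enorm_toLp, ENNReal.ofReal_add (by positivity)
    (by positivity), ENNReal.ofReal_mul hα, ← ENNReal.ofReal_rpow_of_nonneg (norm_nonneg _) hp0,
    ENNReal.ofReal_pow (norm_nonneg _), ofReal_norm, ofReal_norm]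

theorem exists_norm_map_inclusion_le (h : BesovEmbeds 𝕜 Ω sR pR sD pD)
    (W : BesovWaveletBasis 𝕜 Ω sR pR hpR Λ) {F : besovSpace 𝕜 Ω sD pD hpD →ₗ[𝕜] L2 𝕜 Ω}
    (hF : IsBoundedOp F) : ∃ C : ℝ, ∀ x : besovSpace 𝕜 Ω sR pR hpR,
      ‖F (Submodule.inclusion h.le x)‖ ≤ C * ‖W.toLp x‖ := by
  obtain ⟨C₁, hC₁⟩ := hF
  obtain ⟨C₂, hC₂⟩ := id h
  obtain ⟨C₃, hC₃⟩ := W.exists_besovNorm_le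
  refine ⟨C₁ * (C₂ * C₃), fun x => ?_⟩
  have h1 : ‖F (Submodule.inclusion h.le x)‖ₑ ≤ C₁ * (C₂ * (C₃ * ‖W.toLp x‖ₑ)) :=
    (hC₁ _).trans (mul_le_mul_right ((hC₂ x x.2).trans (mul_le_mul_right (hC₃ x) _)) _)
  have h2 := ENNReal.toReal_mono (by finiteness) h1
  simpa [mul_assoc] using h2

end Convergence

theorem even_of_module (𝕜 : Type*) {X : Type*} [RCLike 𝕜] [AddCommGroup X] [Module 𝕜 X] (x : X) :
    Even x := by
  refine ⟨(2⁻¹ : 𝕜) • x, ?_⟩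
  rw [← add_smul, ← two_mul, mul_inv_cancel₀ two_ne_zero, one_smul]

/-- Tikhonov regularization converges to the minimum-norm solution. -/
theorem tendsto_of_tikhonov_le {X Y H ι : Type*} [AddCommGroup X] [NormedAddCommGroup Y]
    [NormedSpace ℝ Y] [NormedAddCommGroup H] [NormedSpace ℝ H] {p C : ℝ} {Φ : X →+ Y} {f : X →+ H}
    {v : H} {u₀ : X} (hp : 0 < p) (hY : UniformConvexPow p Y)
    (hX : ∀ x : X, Even x) (hf : ∀ x, ‖f x‖ ≤ C * ‖Φ x‖)
    (hΦ : ∀ x : ℕ → X, CauchySeq (fun n => Φ (x n)) →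
      ∃ y, Tendsto (fun n => Φ (x n)) atTop (𝓝 (Φ y)))
    (hu₀ : f u₀ = v) (hmin : ∀ w, f w = v → ‖Φ u₀‖ ≤ ‖Φ w‖)
    {l : Filter ι} {δ α : ι → ℝ} {vδ : ι → H} {x : ι → X}
    (hδ : Tendsto δ l (𝓝[>] 0)) (hvδ : ∀ᶠ i in l, ‖v - vδ i‖ ≤ δ i)
    {c₁ c₂ : ℝ} (hc₁ : 0 < c₁) (hα : ∀ᶠ i in l, c₁ * δ i ≤ α i ∧ α i ≤ c₂ * δ i)
    (hx : ∀ᶠ i in l, ‖f (x i) - vδ i‖ ^ 2 + α i * ‖Φ (x i)‖ ^ p ≤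
      ‖v - vδ i‖ ^ 2 + α i * ‖Φ u₀‖ ^ p) :
    Tendsto (fun i => Φ (x i)) l (𝓝 (Φ u₀)) := by
  have hδ0 : Tendsto δ l (𝓝 0) := tendsto_nhds_of_tendsto_nhdsWithin hδ
  have hδpos : ∀ᶠ i in l, 0 < δ i := hδ.eventually self_mem_nhdsWithin
  have hM : 0 ≤ ‖Φ u₀‖ ^ p := by positivity
  refine tendsto_norm_sub_of_norm_le hp hY hX hf hΦ hu₀ hmin ?_ fun η hη => ?_
  · rw [tendsto_iff_norm_sub_tendsto_zero]
    -- The upper bound on `α` makes the residual vanish: dropping the penalty of `x i` bounds its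
    -- square by this radicand.
    have hlim : Tendsto (fun i => √(δ i ^ 2 + c₂ * δ i * ‖Φ u₀‖ ^ p) + δ i) l (𝓝 0) := by
      have h1 := (((hδ0.pow 2).add ((hδ0.const_mul c₂).mul_const (‖Φ u₀‖ ^ p))).sqrt).add hδ0
      simpa using h1
    refine squeeze_zero' (Eventually.of_forall fun _ => norm_nonneg _) ?_ hlim
    filter_upwards [hvδ, hα, hx, hδpos] with i h1 h2 h3 h4
    have h5 : 0 ≤ α i := le_trans (by positivity) h2.1
    have h6 : ‖f (x i) - vδ i‖ ≤ √(δ i ^ 2 + c₂ * δ i * ‖Φ u₀‖ ^ p) := by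
      refine Real.le_sqrt_of_sq_le ?_
      have h7 : ‖v - vδ i‖ ^ 2 ≤ δ i ^ 2 := by gcongr
      have h8 : α i * ‖Φ u₀‖ ^ p ≤ c₂ * δ i * ‖Φ u₀‖ ^ p := by
        gcongr
        exact h2.2
      have h9 : 0 ≤ α i * ‖Φ (x i)‖ ^ p := by positivity
      linarith
    calc ‖f (x i) - v‖ = ‖(f (x i) - vδ i) - (v - vδ i)‖ := by rw [sub_sub_sub_cancel_right]
      _ ≤ ‖f (x i) - vδ i‖ + ‖v - vδ i‖ := norm_sub_le _ _
      _ ≤ _ := add_le_add h6 h1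
  -- The lower bound on `α` enters here: once `δ < c₁ η`, one has `δ² ≤ c₁ δ η ≤ α η`.
  · filter_upwards [hvδ, hα, hx, hδpos, hδ0.eventually_lt_const (by positivity : 0 < c₁ * η)]
      with i h1 h2 h3 h4 h5
    have h6 : 0 < α i := lt_of_lt_of_le (by positivity) h2.1
    have h7 : ‖v - vδ i‖ ^ 2 ≤ α i * η := by
      have h8 : ‖v - vδ i‖ ^ 2 ≤ δ i ^ 2 := by gcongr
      have h9 : δ i * δ i ≤ δ i * (c₁ * η) := by gcongr
      have h10 : c₁ * δ i * η ≤ α i * η := by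
        gcongr
        exact h2.1
      nlinarith
    have h8 : α i * ‖Φ (x i)‖ ^ p ≤ α i * (‖Φ u₀‖ ^ p + η) := by
      have := sq_nonneg ‖f (x i) - vδ i‖
      linarith
    exact le_of_mul_le_mul_left h8 h6

end BesovTikhonov

end

theorem mainTheorem1 {𝕜 : Type*} [RCLike 𝕜] {d : ℕ} (Ω : Opens (Space d))
    (sD sR pD pR : ℝ) (hpD : 1 < pD) (hpR : 1 < pR)
    (hRD : BesovEmbeds 𝕜 Ω sR pR sD pD)
    {Λ : Type*} (W : BesovWaveletBasis 𝕜 Ω sR pR hpR.le Λ)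
    (F : besovSpace 𝕜 Ω sD pD hpD.le →ₗ[𝕜] L2 𝕜 Ω) (hF : IsBoundedOp F)
    (v : L2 𝕜 Ω) (udag : besovSpace 𝕜 Ω sD pD hpD.le) (hudag : IsMinNormSolution W F v udag)
    {ι : Type*} (l : Filter ι) (δ α : ι → ℝ) (vδ : ι → L2 𝕜 Ω)
    (u : ι → besovSpace 𝕜 Ω sD pD hpD.le)
    (hδ : Tendsto δ l (𝓝[>] 0))
    (hvδ : ∀ᶠ i in l, ‖v - vδ i‖ ≤ δ i)
    (hα : ∃ c C : ℝ, 0 < c ∧ 0 < C ∧ ∀ᶠ i in l, c * δ i ≤ α i ∧ α i ≤ C * δ i)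
    (hu : ∀ᶠ i in l, ∀ w : besovSpace 𝕜 Ω sD pD hpD.le,
      tikhonov W F (vδ i) (α i) (u i) ≤ tikhonov W F (vδ i) (α i) w) :
    Tendsto (fun i => W.norm ((u i - udag : besovSpace 𝕜 Ω sD pD hpD.le) : 𝓓'(Ω, 𝕜))) l (𝓝 0) := by
  have hp0 : 0 < pR := by linarith
  have hFact : Fact (1 ≤ ENNReal.ofReal pR) :=
    ⟨by simpa using ENNReal.ofReal_le_ofReal hpR.le⟩
  obtain ⟨hv, htop, hmin⟩ := hudag
  obtain ⟨c₁, c₂, hc₁, -, hα⟩ := hα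
  have hδpos : ∀ᶠ i in l, 0 < δ i := hδ.eventually self_mem_nhdsWithin
  obtain ⟨C, hC⟩ := exists_norm_map_inclusion_le hRD W hF
  have hmem : (udag : 𝓓'(Ω, 𝕜)) ∈ besovSpace 𝕜 Ω sR pR hpR.le := by
    by_contra h
    have h1 : W.norm (udag : 𝓓'(Ω, 𝕜)) = ⊤ := dif_neg h
    exact htop.ne h1
  obtain ⟨u₀, rfl⟩ : ∃ u₀, Submodule.inclusion hRD.le u₀ = udag := ⟨⟨udag, hmem⟩, rfl⟩
  have hx : ∀ i, ∃ x : besovSpace 𝕜 Ω sR pR hpR.le, tikhonov W F (vδ i) (α i) (u i) < ⊤ →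
      0 < α i → Submodule.inclusion hRD.le x = u i := by
    intro i
    by_cases h : tikhonov W F (vδ i) (α i) (u i) < ⊤ ∧ 0 < α i
    · exact ⟨⟨u i, mem_besovSpace_of_tikhonov_lt_top h.2 h.1⟩, fun _ _ => rfl⟩
    · exact ⟨0, fun h1 h2 => absurd ⟨h1, h2⟩ h⟩
  choose x hx using hx
  have hxu : ∀ᶠ i in l, Submodule.inclusion hRD.le (x i) = u i ∧
      ‖F (Submodule.inclusion hRD.le (x i)) - vδ i‖ ^ 2 + α i * ‖W.toLp (x i)‖ ^ pR ≤
        ‖v - vδ i‖ ^ 2 + α i * ‖W.toLp u₀‖ ^ pR := by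
    filter_upwards [hα, hu, hδpos] with i h1 h2 h3
    have hα0 : 0 < α i := lt_of_lt_of_le (by positivity) h1.1
    have h4 := h2 (Submodule.inclusion hRD.le u₀)
    have h5 := tikhonov_inclusion hRD W F (vδ i) hα0.le u₀
    have h6 : Submodule.inclusion hRD.le (x i) = u i := by
      refine hx i (h4.trans_lt ?_) hα0
      rw [h5]
      exact ENNReal.ofReal_lt_top
    rw [← h6, h5, tikhonov_inclusion hRD W F (vδ i) hα0.le (x i),
      ENNReal.ofReal_le_ofReal_iff (by positivity), hv] at h4
    exact ⟨h6, h4⟩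
  have hmain : Tendsto (fun i => W.toLp (x i)) l (𝓝 (W.toLp u₀)) := by
    refine tendsto_of_tikhonov_le (C := C) (v := v)
      (f := (F ∘ₗ Submodule.inclusion hRD.le).toAddMonoidHom) hp0
      (uniformConvexPow_lp hp0 (uniformConvexPow_of_strictConvexSpace hpR))
      (even_of_module 𝕜) hC (fun _ => W.exists_tendsto_toLp) hv (fun w hw => ?_) hδ hvδ hc₁ hα
      (hxu.mono fun i hi => hi.2)
    have h1 := hmin (Submodule.inclusion hRD.le w) hw
    rw [Submodule.coe_inclusion, Submodule.coe_inclusion, W.norm_eq_enorm_toLp,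
      W.norm_eq_enorm_toLp] at h1
    exact enorm_le_iff_norm_le.1 h1
  rw [tendsto_iff_edist_tendsto_0] at hmain
  refine hmain.congr' (hxu.mono fun i hi => ?_)
  beta_reduce
  rw [← hi.1, ← map_sub, Submodule.coe_inclusion, W.norm_eq_enorm_toLp, map_sub,
    edist_eq_enorm_sub]
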